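/- Let $S$ be a finite set of sites. For any two distinct sites $p,q\in S$ let the bisector $J(p,q)=J(q,p)\subset\mathbb{R}^2$ be the common boundary of two disjoint open sets $D(p,q)$ (the dominance region of $p$) and $D(q,p)$ (that of $q$), with $\mathbb{R}^2\setminus J(p,q)=D(p,q)\cup D(q,p)$. For $S'\subseteq S$ and $p\in S'$ put $\mathrm{VR}(p,S')=\bigcap_{q\in S'\setminus\{p\}}D(p,q)$ and $\mathcal V(S')=\mathbb{R}^2\setminus\bigcup_{p\in S'}\mathrm{VR}(p,S')$ (the abstract Voronoi diagram of $S'$); its Voronoi vertices are the points that lie in the closures of at least three of its regions. Assume that the bisector system is admissible, i.e. that for every non-empty $S'\subseteq S$: (A1) each region $\mathrm{VR}(p,S')$, $p\in S'$, is non-empty and pathwise connected; (A2) each point of the plane belongs to the closure of some region $\mathrm{VR}(p,S')$, $p\in S'$; (A3) each bisector is an unbounded simple curve homeomorphic to a line (a closed embedded copy of $\mathbb{R}$); (A4) any two distinct bisectors intersect transversally and in a finite number of points; and that it is in general position: no three bisectors involving one common site pass through the same point. Let $G$ be a finite plane graph, with at least one edge, on the arrangement of the bisectors in the whole plane: its vertices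 are intersection points of bisectors, each edge is a maximal arc of some bisector $J(p,q)$ without a vertex of $G$ in its interior, each end of an edge is either a vertex of $G$ or goes to infinity (a leaf at infinity), and distinct edges meet only in vertices. Suppose that $G$ is Voronoi-like, i.e. that * every vertex $v$ of $G$ is locally Voronoi: there are three distinct sites $p,q,r$ with $v\in J(p,q)\cap J(q,r)\cap J(p,r)$ and a neighbourhood $N$ of $v$ with $G\cap N=\mathcal V(\{p,q,r\})\cap N$; and * if $G$ is disconnected, then consecutive leaves at infinity have consistent labels: for some compact set $K$, each connected component $U$ of $\mathbb{R}^2\setminus(K\cup G)$ receives the same label from all edges of $G$ to which it is incident outside $K$, where an edge on $J(p,q)$ to which $U$ is incident from the side of $D(p,q)$ gives it the label $p$. Let $S_G$ be the set of the sites involved in the edges of $G$. Then $G$ equals the Voronoi diagram of $S_G$: as a point set $G=\mathcal V(S_G)$, and the vertices of $G$ are exactly the Voronoi vertices of $\mathcal V(S_G)$. -/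

import Mathlib

open Set Topology

/-- The plane. -/
abbrev Plane : Type := EuclideanSpace ℝ (Fin 2)

/-- A system of bisectors on the sites `ι`: every two distinct sites `p`, `q` have a bisector
`bis p q = bis q p`, which subdivides the plane into the two open dominance regions `dom p q`
(of `p`) and `dom q p` (of `q`) and is their common boundary. Values at `p = q` are irrelevant. -/
structure BisectorSystem (ι : Type*) where
  bis : ι → ι → Set Plane
  dom : ι → ι → Set Plane
  bis_symm : ∀ p q, bis p q = bis q p
  isOpen_dom : ∀ p q, p ≠ q → IsOpen (dom p q)
  disjoint_dom : ∀ p q, p ≠ q → Disjoint (dom p q) (dom q p)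
  compl_bis : ∀ p q, p ≠ q → (bis p q)ᶜ = dom p q ∪ dom q p
  frontier_dom : ∀ p q, p ≠ q → frontier (dom p q) = bis p q

namespace BisectorSystem

variable {ι : Type*} (B : BisectorSystem ι)

/-- The Voronoi region `VR(p, S)`. -/
def region (p : ι) (S : Set ι) : Set Plane := ⋂ q ∈ S \ {p}, B.dom p q

/-- The Voronoi diagram `V(S)`: the complement of the union of all Voronoi regions. -/
def diagram (S : Set ι) : Set Plane := (⋃ p ∈ S, B.region p S)ᶜ

/-- The Voronoi vertices of `V(S)`: the points incident to (at least) three Voronoi regions. -/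
def voronoiVertices (S : Set ι) : Set Plane :=
  {v | ∃ p ∈ S, ∃ q ∈ S, ∃ r ∈ S, p ≠ q ∧ p ≠ r ∧ q ≠ r ∧
    v ∈ closure (B.region p S) ∧ v ∈ closure (B.region q S) ∧ v ∈ closure (B.region r S)}

/-- The bisectors of `p, q` and of `r, s` intersect transversally and in finitely many points: at
each common point, each of the two curves runs into both sides of the other one. -/
def Transversal (p q r s : ι) : Prop :=
  (B.bis p q ∩ B.bis r s).Finite ∧
    ∀ x ∈ B.bis p q ∩ B.bis r s,
      (x ∈ closure (B.bis p q ∩ B.dom r s) ∧ x ∈ closure (B.bis p q ∩ B.dom s r)) ∧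
      (x ∈ closure (B.bis r s ∩ B.dom p q) ∧ x ∈ closure (B.bis r s ∩ B.dom q p))

/-- Admissible bisector systems. -/
structure Admissible : Prop where
  /-- (A1) Voronoi regions are non-empty and pathwise connected. -/
  regions : ∀ S : Set ι, ∀ p ∈ S, (B.region p S).Nonempty ∧ IsPathConnected (B.region p S)
  /-- (A2) Every point of the plane lies in the closure of a Voronoi region. -/
  cover : ∀ S : Set ι, S.Nonempty → ∀ x : Plane, ∃ p ∈ S, x ∈ closure (B.region p S)
  /-- (A3) Bisectors are unbounded simple curves homeomorphic to a line
  (both ends tend to infinity). -/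
  curve : ∀ p q, p ≠ q → ∃ γ : ℝ → Plane, IsClosedEmbedding γ ∧ range γ = B.bis p q
  /-- (A4) Any two bisectors intersect transversally and in finitely many points. -/
  transversal : ∀ p q r s, p ≠ q → r ≠ s → s(p, q) ≠ s(r, s) → B.Transversal p q r s

/-- General position: no three bisectors that involve one common site meet in a point. -/
def GeneralPosition : Prop :=
  ∀ p q r s, p ≠ q → p ≠ r → p ≠ s → q ≠ r → q ≠ s → r ≠ s →
    B.bis p q ∩ B.bis p r ∩ B.bis p s = ∅

/-- `v` is a vertex of the arrangement of all bisectors. -/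
def IsArrangementVertex (v : Plane) : Prop :=
  ∃ p q r s, p ≠ q ∧ r ≠ s ∧ s(p, q) ≠ s(r, s) ∧ v ∈ B.bis p q ∩ B.bis r s

/-- A finite plane graph on the arrangement of the bisectors, in the whole plane. Its vertices are
arrangement vertices. An edge is a pair `(s(p, q), α)`, where `α` (the edge without its endpoints)
is a maximal arc of `bis p q` that is free of vertices of the graph. An end of `α` is
a vertex of the graph, or it goes to infinity; an end of the latter kind is
a leaf of the graph, at infinity. Distinct edges do not meet outside of the vertices. -/
structure ArrangementGraph where
  verts : Set Plane
  edges : Set (Sym2 ι × Set Plane)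
  finite_verts : verts.Finite
  verts_arrangement : ∀ v ∈ verts, B.IsArrangementVertex v
  edges_maximal : ∀ p q α, (s(p, q), α) ∈ edges →
    p ≠ q ∧ ∃ x ∈ B.bis p q \ verts, α = connectedComponentIn (B.bis p q \ verts) x
  edges_disjoint : ∀ e ∈ edges, ∀ f ∈ edges, e ≠ f → Disjoint e.2 f.2

namespace ArrangementGraph

variable {B} (G : B.ArrangementGraph)

/-- The points of the plane that lie on the graph. -/
def carrier : Set Plane := G.verts ∪ ⋃ e ∈ G.edges, e.2

/-- The relevant sites: those involved in the edges of the graph. -/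
def sites : Set ι := {p | ∃ q α, (s(p, q), α) ∈ G.edges}

/-- `v` is locally Voronoi (of the nearest type): for three sites `p, q, r` that define `v`,
the graph coincides with `V({p, q, r})` in a neighbourhood of `v`. -/
def IsLocallyVoronoi (v : Plane) : Prop :=
  ∃ p q r, p ≠ q ∧ p ≠ r ∧ q ≠ r ∧ v ∈ B.bis p q ∧ v ∈ B.bis q r ∧ v ∈ B.bis p r ∧
    ∃ N ∈ 𝓝 v, G.carrier ∩ N = B.diagram {p, q, r} ∩ N

/-- Outside the compact set `K`, the set `U` is incident to an edge of `bis p q`, for some `q`,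
from the side that this bisector labels `p`. -/
def HasLabel (K U : Set Plane) (p : ι) : Prop :=
  ∃ q α, (s(p, q), α) ∈ G.edges ∧ ∃ x ∈ α \ K, x ∈ closure (U ∩ B.dom p q)

/-- Consecutive leaves at infinity have consistent labels: after removal of a sufficiently large
compact set `K`, each component `U` of the complement of the graph (a sector at infinity between
two consecutive leaves) gets the same label from all the edges it is incident to. -/
def ConsistentLeaves : Prop :=
  ∃ K : Set Plane, IsCompact K ∧ ∀ y ∈ (K ∪ G.carrier)ᶜ, ∀ p r : ι,
    G.HasLabel K (connectedComponentIn (K ∪ G.carrier)ᶜ y) p →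
    G.HasLabel K (connectedComponentIn (K ∪ G.carrier)ᶜ y) r → p = r

/-- Voronoi-like graphs in the whole plane. -/
structure IsVoronoiLike : Prop where
  locallyVoronoi : ∀ v ∈ G.verts, G.IsLocallyVoronoi v
  consistent : ¬ IsConnected G.carrier → G.ConsistentLeaves

end ArrangementGraph

end BisectorSystem

/-!
At each point `x` of the plane, the relation "`x` lies in `dom p q`" is a strict weak order on the
sites (`beats_trans`, `beats_or`), and the Voronoi diagram of `S` consists of the points where the
best site of `S` is not unique. Near each of its points `x`, a Voronoi-like graph `G` is the Voronoi
diagram of the two or three sites incident to `x` (`ArrangementGraph.isLocalDiagram`).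

**Uniqueness from a labelling.** Suppose that the faces of `G` can be labelled by sites that agree
with these local diagrams. A non-empty open set that is, at each of its boundary points, locally a
Voronoi region of `q`, contains the whole region of `q`, because regions are connected
(`region_subset_of_locally_region`). This applies to the union of the faces labelled `q`, and also
to the set of the points at which `q` is better than the label of their face. These two sets are
disjoint, and the first one is not empty if `q` is a relevant site; hence the second one is empty.
So the label of each face is the best site at all its points, and `G` is the Voronoi diagram of
the relevant sites (`IsLabelling.eq_diagram`).

**Existence of the labelling.** The labels near `G` are the difference of a function `a`, locally
constant near `G`, and a function `b`, locally constant off `G`, because the plane has no first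
cohomology (`exists_int_splitting`). If `a` is constant on `G`, then `b` extends the labels to the
faces. This is the case if `G` is connected. In particular, each connected component of `G` is
itself a Voronoi diagram, and therefore it is unbounded (`IsLocalDiagram.not_isBounded`). If `G` is
disconnected, the consistency of the leaves provides labels outside of a large disk; there `a`
extends to a locally constant function, which is constant as the complement of a disk is connected.
Since all components of `G` leave the disk, `a` is constant on `G` (`exists_labelling_of_outside`).
-/

/-! ### Locally constant functions and relatively clopen sets -/

theorem continuousOn_int_of_cast {X : Type*} [TopologicalSpace X] {s : Set X} {k : X → ℝ}
    {a : X → ℤ} (hk : ContinuousOn k s) (h : ∀ x ∈ s, (a x : ℝ) = k x) : ContinuousOn a s := by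
  rw [Int.isClosedEmbedding_coe_real.isInducing.continuousOn_iff]
  exact hk.congr h

/-- The vanishing of the first cohomology of a simply connected space, in Mayer–Vietoris form: a
locally constant integer function on the overlap of two open sets that cover the space is a
difference of locally constant functions on the two sets. A partition of unity splits it into a
difference of real functions; these agree modulo `1`, so they define a map to the circle, whose
lift to `ℝ` is what has to be subtracted from both of them. -/
theorem exists_int_splitting {X : Type*} [TopologicalSpace X] [SimplyConnectedSpace X]
    [LocallyPathConnectedSpace X] [NormalSpace X] {U V : Set X} (hU : IsOpen U) (hV : IsOpen V)
    (hUV : U ∪ V = univ) {f : X → ℤ} (hf : ContinuousOn f (U ∩ V)) :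
    ∃ a b : X → ℤ, ContinuousOn a U ∧ ContinuousOn b V ∧ ∀ x ∈ U ∩ V, f x = a x - b x := by
  classical
  have hmem : ∀ x, x ∉ V → x ∈ U := fun x hx =>
    ((hUV ▸ mem_univ x : x ∈ U ∪ V)).resolve_right hx
  obtain ⟨O₁, hO₁, hVO, hOU⟩ := normal_exists_closure_subset hV.isClosed_compl hU
    (fun x hx => hmem x hx)
  obtain ⟨O₂, hO₂, hUO, hOO⟩ := normal_exists_closure_subset hU.isClosed_compl
    (isClosed_closure (s := O₁)).isOpen_compl (compl_subset_compl.2 hOU)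
  obtain ⟨φ, hφ0, hφ1, -⟩ := exists_continuous_zero_one_of_isClosed
    (isClosed_closure (s := O₁)) (isClosed_closure (s := O₂))
    (disjoint_left.2 fun x hx hx' => hOO hx' hx)
  have hf' : ∀ x ∈ U ∩ V, ContinuousAt (fun y => (f y : ℝ)) x := fun x hx =>
    (continuous_of_discreteTopology (f := fun n : ℤ => (n : ℝ))).continuousAt.comp
      (hf.continuousAt ((hU.inter hV).mem_nhds hx))
  set g : X → ℝ := fun x => if x ∈ V then f x * φ x else 0 with hg
  set h : X → ℝ := fun x => if x ∈ U then -(f x * (1 - φ x)) else 0 with hh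
  have hgc : ∀ x ∈ U, ContinuousAt g x := by
    intro x hx
    by_cases hxV : x ∈ V
    · have : g =ᶠ[𝓝 x] fun y => f y * φ y := by
        filter_upwards [hV.mem_nhds hxV] with y hy using if_pos hy
      exact ((hf' x ⟨hx, hxV⟩).mul φ.continuous.continuousAt).congr this.symm
    · have : g =ᶠ[𝓝 x] fun _ => 0 := by
        filter_upwards [hO₁.mem_nhds (hVO hxV)] with y hy
        simp [hg, show φ y = 0 from hφ0 (subset_closure hy)]
      exact continuousAt_const.congr this.symm
  have hhc : ∀ x ∈ V, ContinuousAt h x := by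
    intro x hx
    by_cases hxU : x ∈ U
    · have : h =ᶠ[𝓝 x] fun y => -(f y * (1 - φ y)) := by
        filter_upwards [hU.mem_nhds hxU] with y hy using if_pos hy
      exact ((hf' x ⟨hxU, hx⟩).mul (continuousAt_const.sub φ.continuous.continuousAt)).neg.congr
        this.symm
    · have : h =ᶠ[𝓝 x] fun _ => 0 := by
        filter_upwards [hO₂.mem_nhds (hUO hxU)] with y hy
        simp [hh, show φ y = 1 from hφ1 (subset_closure hy)]
      exact continuousAt_const.congr this.symm
  have hgh : ∀ x ∈ U ∩ V, g x - h x = f x := by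
    rintro x ⟨hx, hx'⟩
    simp only [hg, hh, if_pos hx, if_pos hx']; ring
  -- `g` and `h` agree modulo `1` on the overlap and define a map to the circle
  set F : X → AddCircle (1 : ℝ) := fun x => if x ∈ U then (g x : AddCircle (1 : ℝ)) else h x with hF
  have hFU : ∀ x ∈ U, F x = g x := fun x hx => if_pos hx
  have hFV : ∀ x ∈ V, F x = h x := by
    intro x hx
    by_cases hxU : x ∈ U
    · rw [hFU x hxU, ← sub_eq_zero, ← AddCircle.coe_sub, hgh x ⟨hxU, hx⟩,
        AddCircle.coe_eq_zero_iff]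
      exact ⟨f x, by simp⟩
    · exact if_neg hxU
  have hFc : Continuous F := by
    rw [continuous_iff_continuousAt]
    intro x
    by_cases hx : x ∈ V
    · refine ((AddCircle.continuous_mk' 1).continuousAt.comp (hhc x hx)).congr ?_
      filter_upwards [hV.mem_nhds hx] with y hy using (hFV y hy).symm
    · refine ((AddCircle.continuous_mk' 1).continuousAt.comp (hgc x (hmem x hx))).congr ?_
      filter_upwards [hU.mem_nhds (hmem x hx)] with y hy using (hFU y hy).symm
  obtain ⟨x₀⟩ : Nonempty X := inferInstance
  obtain ⟨t₀, ht₀⟩ := QuotientAddGroup.mk_surjective (F x₀)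
  obtain ⟨θ, ⟨-, hθ⟩, -⟩ := (AddCircle.isCoveringMap_coe (1 : ℝ)).existsUnique_continuousMap_lifts
    ⟨F, hFc⟩ x₀ t₀ ht₀
  have hθ' : ∀ x, ((θ x : ℝ) : AddCircle (1 : ℝ)) = F x := fun x => congrFun hθ x
  have hint : ∀ u v : ℝ, (u : AddCircle (1 : ℝ)) = v → ((round (u - v) : ℤ) : ℝ) = u - v := by
    intro u v huv
    rw [← sub_eq_zero, ← AddCircle.coe_sub, AddCircle.coe_eq_zero_iff] at huv
    obtain ⟨n, hn⟩ := huv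
    rw [← hn]; simp
  refine ⟨fun x => round (g x - θ x), fun x => round (h x - θ x),
    continuousOn_int_of_cast
      (fun x hx => ((hgc x hx).sub θ.continuous.continuousAt).continuousWithinAt)
      fun x hx => hint _ _ ((hFU x hx).symm.trans (hθ' x).symm),
    continuousOn_int_of_cast
      (fun x hx => ((hhc x hx).sub θ.continuous.continuousAt).continuousWithinAt)
      fun x hx => hint _ _ ((hFV x hx).symm.trans (hθ' x).symm), ?_⟩
  intro x hx
  have h1 := hint _ _ ((hFU x hx.1).symm.trans (hθ' x).symm)
  have h2 := hint _ _ ((hFV x hx.2).symm.trans (hθ' x).symm)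
  have h3 := hgh x hx
  have : ((f x : ℤ) : ℝ) = ((round (g x - θ x) - round (h x - θ x) : ℤ) : ℝ) := by
    push_cast; linarith
  exact_mod_cast this

open Metric in
theorem isPreconnected_compl_closedBall {E : Type*} [NormedAddCommGroup E] [NormedSpace ℝ E]
    (h : 1 < Module.rank ℝ E) {r : ℝ} (hr : 0 ≤ r) : IsPreconnected ((closedBall (0 : E) r)ᶜ) := by
  have himage : (fun x : E => (1 + r / ‖x‖) • x) '' {0}ᶜ = (closedBall (0 : E) r)ᶜ := by
    ext y
    simp only [mem_image, mem_compl_iff, mem_singleton_iff, mem_closedBall, dist_zero_right, not_le]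
    constructor
    · rintro ⟨x, hx, rfl⟩
      have hx' : 0 < ‖x‖ := norm_pos_iff.2 hx
      rw [norm_smul, Real.norm_of_nonneg (by positivity)]
      field_simp
      linarith
    · intro hy
      have hy' : 0 < ‖y‖ := hr.trans_lt hy
      have h1 : 0 < 1 - r / ‖y‖ := by rw [sub_pos, div_lt_one hy']; exact hy
      refine ⟨(1 - r / ‖y‖) • y, smul_ne_zero h1.ne' (norm_pos_iff.1 hy'), ?_⟩
      rw [smul_smul, norm_smul, Real.norm_of_nonneg h1.le]
      have : (1 + r / ((1 - r / ‖y‖) * ‖y‖)) * (1 - r / ‖y‖) = 1 := by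
        have h2 : ‖y‖ - r ≠ 0 := by linarith
        have h3 : (1 - r / ‖y‖) * ‖y‖ = ‖y‖ - r := by field_simp
        rw [h3]; field_simp; ring
      rw [this, one_smul]
  rw [← himage]
  refine (isConnected_compl_singleton_of_one_lt_rank h 0).isPreconnected.image _ ?_
  intro x hx
  have : ‖x‖ ≠ 0 := norm_ne_zero_iff.2 hx
  exact ((continuousAt_const.add (continuousAt_const.div continuous_norm.continuousAt this)).smul
    continuousAt_id).continuousWithinAt

theorem eventually_eq_of_continuousOn {X : Type*} [TopologicalSpace X] {s : Set X} {a : X → ℤ}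
    (ha : ContinuousOn a s) (hs : IsOpen s) {x : X} (hx : x ∈ s) : ∀ᶠ y in 𝓝 x, a y = a x :=
  (ha.continuousAt (hs.mem_nhds hx)).eventually_mem ((isOpen_discrete {a x}).mem_nhds rfl)

theorem continuousOn_of_eventually_eq {X : Type*} {Y : Type*} [TopologicalSpace X]
    [TopologicalSpace Y] {s : Set X} {a : X → Y}
    (h : ∀ x ∈ s, ∀ᶠ y in 𝓝 x, a y = a x) : ContinuousOn a s := fun x hx =>
  (continuousAt_const.congr ((h x hx).mono fun _ => Eq.symm)).continuousWithinAt

theorem eq_of_isPreconnected_of_eventually_eq {X Y : Type*} [TopologicalSpace X] {s : Set X}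
    (hs : IsPreconnected s) {a : X → Y} (h : ∀ x ∈ s, ∀ᶠ y in 𝓝 x, a y = a x) {x y : X}
    (hx : x ∈ s) (hy : y ∈ s) : a x = a y := by
  let _ : TopologicalSpace Y := ⊥
  have : DiscreteTopology Y := ⟨rfl⟩
  exact hs.constant (continuousOn_of_eventually_eq h) hx hy

/-- A union of finitely many preconnected sets has finitely many relatively clopen subsets, so each
non-empty one contains a minimal one, which is connected. -/
theorem exists_isConnected_isClosed_diff {X κ : Type*} [TopologicalSpace X] [Finite κ] {G : Set X}
    {A : κ → Set X} (hA : ∀ i, IsPreconnected (A i)) (hGA : G = ⋃ i, A i) {C : Set X} (hCG : C ⊆ G)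
    (hC : IsClosed C) (hGC : IsClosed (G \ C)) (hne : C.Nonempty) :
    ∃ D ⊆ C, IsClosed D ∧ IsClosed (G \ D) ∧ IsConnected D := by
  set P : Set (Set X) := {D | D ⊆ C ∧ IsClosed D ∧ IsClosed (G \ D) ∧ D.Nonempty}
  have hfin : P.Finite := by
    refine Finite.of_finite_image (f := fun D => {i | (A i ∩ D).Nonempty}) (toFinite _) ?_
    have hsub : ∀ D ∈ P, ∀ D' ∈ P, {i | (A i ∩ D).Nonempty} = {i | (A i ∩ D').Nonempty} →
        D ⊆ D' := by
      intro D hD D' hD' heq x hx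
      obtain ⟨i, hi⟩ := mem_iUnion.1 (hGA ▸ hCG (hD.1 hx))
      obtain ⟨y, hy, hyD'⟩ : i ∈ {i | (A i ∩ D').Nonempty} := heq ▸ ⟨x, hi, hx⟩
      by_contra hxD'
      have hxG : x ∈ G := hCG (hD.1 hx)
      obtain ⟨z, -, hz, hz'⟩ := isPreconnected_closed_iff.1 (hA i) _ _ hD'.2.1 hD'.2.2.1
        (fun z hz => (em (z ∈ D')).imp id fun h => ⟨hGA ▸ mem_iUnion_of_mem i hz, h⟩)
        ⟨y, hy, hyD'⟩ ⟨x, hi, hxG, hxD'⟩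
      exact hz'.2 hz
    exact fun D hD D' hD' heq => (hsub D hD D' hD' heq).antisymm (hsub D' hD' D hD heq.symm)
  obtain ⟨D, ⟨hDC, hD, hGD, hDne⟩, hmin⟩ := hfin.exists_minimal ⟨C, Subset.rfl, hC, hGC, hne⟩
  refine ⟨D, hDC, hD, hGD, hDne, isPreconnected_closed_iff.2 fun t t' ht ht' hcov h₁ h₂ => ?_⟩
  by_contra hdis
  rw [not_nonempty_iff_eq_empty] at hdis
  have hdiff : G \ (D ∩ t) = (G \ D) ∪ (D ∩ t') := by
    ext x
    constructor
    · rintro ⟨hxG, hx⟩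
      by_cases hxD : x ∈ D
      · exact Or.inr ⟨hxD, (hcov hxD).resolve_left fun h => hx ⟨hxD, h⟩⟩
      · exact Or.inl ⟨hxG, hxD⟩
    · rintro (⟨hxG, hx⟩ | ⟨hxD, hx⟩)
      · exact ⟨hxG, fun h => hx h.1⟩
      · exact ⟨hCG (hDC hxD), fun h => (hdis ▸ ⟨hxD, h.2, hx⟩ : x ∈ (∅ : Set X))⟩
  obtain ⟨x, hxD, hx⟩ := h₂
  have := hmin ⟨inter_subset_left.trans hDC, hD.inter ht, hdiff ▸ hGD.union (hD.inter ht'), h₁⟩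
    inter_subset_left hxD
  exact (hdis ▸ ⟨hxD, this.2, hx⟩ : x ∈ (∅ : Set X))

/-! ### The order of the sites at a point -/

namespace BisectorSystem
variable {ι : Type*} {B : BisectorSystem ι}

/-- At the point `x`, the site `p` is strictly preferred to `q`. Unlike membership in `B.dom p q`,
whose value at `p = q` is arbitrary, this is irreflexive. -/
def Beats (B : BisectorSystem ι) (x : Plane) (p q : ι) : Prop := p ≠ q ∧ x ∈ B.dom p q

theorem isOpen_beats (p q : ι) : IsOpen {x | B.Beats x p q} := by
  by_cases h : p = q
  · simp [Beats, h]
  · simpa [Beats, h] using B.isOpen_dom p q h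

theorem beats_irrefl (x : Plane) (p : ι) : ¬ B.Beats x p p := fun h => h.1 rfl

theorem Beats.asymm {x : Plane} {p q : ι} (h : B.Beats x p q) : ¬ B.Beats x q p := fun h' =>
  disjoint_left.1 (B.disjoint_dom p q h.1) h.2 h'.2

theorem mem_bis_iff {x : Plane} {p q : ι} (h : p ≠ q) :
    x ∈ B.bis p q ↔ ¬ B.Beats x p q ∧ ¬ B.Beats x q p := by
  have := congrArg (x ∈ ·) (B.compl_bis p q h)
  simp only [mem_compl_iff, mem_union, eq_iff_iff] at this
  simp only [Beats, ne_eq, h, Ne.symm h, not_false_eq_true, true_and]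
  tauto

theorem mem_closure_dom {x : Plane} {p q : ι} (h : p ≠ q) (hx : x ∈ B.bis p q) :
    x ∈ closure (B.dom p q) := by
  rw [← B.frontier_dom p q h] at hx
  exact frontier_subset_closure hx

theorem isClosed_bis {p q : ι} (h : p ≠ q) : IsClosed (B.bis p q) := by
  rw [← B.frontier_dom p q h]; exact isClosed_frontier

theorem mem_region_iff {x : Plane} {p : ι} {S : Set ι} :
    x ∈ B.region p S ↔ ∀ q ∈ S, q ≠ p → B.Beats x p q := by
  simp only [region, mem_iInter, mem_sdiff, mem_singleton_iff, Beats, and_imp]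
  exact forall₃_congr fun q _ hq => by simp [Ne.symm hq]

theorem isOpen_region [Finite ι] (p : ι) (S : Set ι) : IsOpen (B.region p S) := by
  have : B.region p S = ⋂ q ∈ S \ {p}, {x | B.Beats x p q} := by
    ext x; simp [mem_region_iff]
  rw [this]
  exact (toFinite _).isOpen_biInter fun q _ => isOpen_beats p q

theorem disjoint_region {p q : ι} {S : Set ι} (hp : p ∈ S) (hq : q ∈ S) (hpq : p ≠ q) :
    Disjoint (B.region p S) (B.region q S) :=
  disjoint_left.2 fun _ h h' =>
    (mem_region_iff.1 h q hq hpq.symm).asymm (mem_region_iff.1 h' p hp hpq)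

/-- Preference is transitive: otherwise some non-empty open set would meet no region of the diagram
of the three sites, in spite of (A2). -/
theorem Admissible.beats_trans (hB : B.Admissible) {x : Plane} {p q r : ι}
    (h₁ : B.Beats x p q) (h₂ : B.Beats x q r) : B.Beats x p r := by
  have hpr : p ≠ r := by rintro rfl; exact h₁.asymm h₂
  -- on the open set where `p` beats `q` and `q` beats `r`, neither `q` nor `r` has a region
  have key : ∀ y, B.Beats y p q → B.Beats y q r → y ∉ B.dom r p := by
    intro y hy₁ hy₂ hy
    obtain ⟨s, hs, hys⟩ := hB.cover {p, q, r} ⟨p, by simp⟩ y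
    obtain ⟨z, ⟨⟨hz₁, hz₂⟩, hz₃⟩, hzs⟩ := mem_closure_iff.1 hys _
      (((isOpen_beats p q).inter (isOpen_beats q r)).inter (isOpen_beats r p))
      ⟨⟨hy₁, hy₂⟩, hpr.symm, hy⟩
    rw [mem_region_iff] at hzs
    rcases hs with rfl | rfl | rfl
    · exact (hzs r (by simp) hpr.symm).asymm hz₃
    · exact (hzs p (by simp) h₁.1).asymm hz₁
    · exact (hzs q (by simp) h₂.1).asymm hz₂
  by_contra hx
  have hx' : x ∈ B.bis r p := (mem_bis_iff hpr.symm).2 ⟨fun h => key x h₁ h₂ h.2, hx⟩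
  obtain ⟨z, ⟨hz₁, hz₂⟩, hz₃⟩ := mem_closure_iff.1 (mem_closure_dom hpr.symm hx') _
      ((isOpen_beats p q).inter (isOpen_beats q r)) ⟨h₁, h₂⟩
  exact key z hz₁ hz₂ hz₃

/-- Sites that are tied at a point have the same inferiors there. This is where transversality
enters. -/
theorem Admissible.beats_of_mem_bis (hB : B.Admissible) {x : Plane} {p q r : ι} (hpq : p ≠ q)
    (h₁ : x ∈ B.bis p q) (h₂ : B.Beats x p r) : B.Beats x q r := by
  have hn := (mem_bis_iff hpq).1 h₁
  have hqr : q ≠ r := by rintro rfl; exact hn.1 h₂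
  by_contra h
  have hrq : ¬ B.Beats x r q := fun h' => hn.1 (hB.beats_trans h₂ h')
  have hx : x ∈ B.bis q r := (mem_bis_iff hqr).2 ⟨h, hrq⟩
  -- otherwise `bis p q` runs into the side of `r` on `bis q r`, which transitivity forbids
  have ht := (hB.transversal p q q r hpq hqr (by
    simp only [ne_eq, Sym2.eq_iff]; rintro (⟨rfl, rfl⟩ | ⟨rfl, -⟩)
    · exact hpq rfl
    · exact h₂.1 rfl)).2 x ⟨h₁, hx⟩
  obtain ⟨y, hy₁, hy₂, hy₃⟩ := mem_closure_iff.1 ht.1.2 _ (isOpen_beats p r) h₂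
  exact ((mem_bis_iff hpq).1 hy₂).1 (hB.beats_trans hy₁ ⟨hqr.symm, hy₃⟩)

/-- Negative transitivity: with `beats_trans`, the preferences at each point form a strict weak
order on the sites. -/
theorem Admissible.beats_or (hB : B.Admissible) {x : Plane} {p r : ι} (h : B.Beats x p r) (q : ι) :
    B.Beats x p q ∨ B.Beats x q r := by
  by_cases hpq : p = q
  · exact Or.inr (hpq ▸ h)
  by_cases h₁ : B.Beats x p q
  · exact Or.inl h₁
  by_cases h₂ : B.Beats x q p
  · exact Or.inr (hB.beats_trans h₂ h)
  · exact Or.inr (hB.beats_of_mem_bis hpq ((mem_bis_iff hpq).2 ⟨h₁, h₂⟩) h)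

/-- The sites of `S` that no other site of `S` is preferred to at `x`. -/
def top (B : BisectorSystem ι) (x : Plane) (S : Set ι) : Set ι := {p ∈ S | ∀ q ∈ S, ¬ B.Beats x q p}

theorem Admissible.top_nonempty [Finite ι] (hB : B.Admissible) (x : Plane) {S : Set ι}
    (hS : S.Nonempty) : (B.top x S).Nonempty := by
  let _ : Preorder ι :=
    { le := fun p q => ¬ B.Beats x p q
      le_refl := fun p => beats_irrefl x p
      le_trans := fun p q r h₁ h₂ h => (hB.beats_or h q).elim h₁ h₂ }
  obtain ⟨m, hm⟩ := (toFinite S).exists_maximal hS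
  exact ⟨m, hm.1, fun q hq hqm => hm.2 hq hqm.asymm hqm⟩

/-- The Voronoi diagram is the set of the points at which the best site is not unique. -/
theorem Admissible.mem_diagram_iff [Finite ι] (hB : B.Admissible) {x : Plane} {S : Set ι}
    (hS : S.Nonempty) : x ∈ B.diagram S ↔ (B.top x S).Nontrivial := by
  simp only [diagram, mem_compl_iff, mem_iUnion, not_exists]
  constructor
  · intro h
    obtain ⟨p, hp⟩ := hB.top_nonempty x hS
    have := h p hp.1
    simp only [mem_region_iff, not_forall] at this
    obtain ⟨q, hq, hqp, hpq⟩ := this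
    refine ⟨p, hp, q, ⟨hq, fun r hr hrq => ?_⟩, hqp.symm⟩
    exact (hB.beats_or hrq p).elim (hp.2 r hr) hpq
  · rintro ⟨p, hp, q, hq, hpq⟩ s hs hx
    rw [mem_region_iff] at hx
    by_cases hsp : p = s
    · subst hsp; exact hq.2 p hs (hx q hq.1 hpq.symm)
    · exact hp.2 s hs (hx p hp.1 hsp)

theorem notMem_diagram_iff {x : Plane} {S : Set ι} :
    x ∉ B.diagram S ↔ ∃ p ∈ S, x ∈ B.region p S := by
  simp [diagram]

theorem mem_bis_of_tie {x : Plane} {S : Set ι} {p q : ι} (hp : p ∈ B.top x S) (hq : q ∈ B.top x S)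
    (hpq : p ≠ q) : x ∈ B.bis p q :=
  (mem_bis_iff hpq).2 ⟨hq.2 p hp.1, hp.2 q hq.1⟩

end BisectorSystem

/-! ### Local Voronoi diagrams with labelled faces -/

namespace BisectorSystem
variable {ι : Type*} {B : BisectorSystem ι}

theorem Admissible.isPreconnected_region (hB : B.Admissible) (p : ι) (S : Set ι) :
    IsPreconnected (B.region p S) := by
  have : B.region p S = B.region p (insert p S) := by
    ext x; simp +contextual [mem_region_iff]
  rw [this]
  exact (hB.regions _ p (mem_insert _ _)).2.isConnected.isPreconnected

/-- A non-empty open set that looks, at each of its boundary points, like a Voronoi region of `q`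
with respect to some of the sites in `S`, contains the whole region of `q` with respect to `S`. If
`T'` is a largest subset of `S` whose region of `q` meets `F`, then a boundary point of `F` in this
region would be defined by a site outside of `T'`, which contradicts maximality; as the region is
connected, it lies in `F`. -/
theorem Admissible.region_subset_of_locally_region [Finite ι] (hB : B.Admissible) {F : Set Plane}
    (hF : IsOpen F) (hne : F.Nonempty) {q : ι} {S : Set ι}
    (hloc : ∀ x ∈ frontier F, ∃ T ⊆ S, (∃ t ∈ T, t ≠ q ∧ ¬ B.Beats x q t) ∧
      ∀ᶠ y in 𝓝 x, y ∈ F ↔ y ∈ B.region q T) :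
    B.region q S ⊆ F := by
  obtain ⟨T', ⟨hT'S, hT'ne⟩, hmax⟩ :=
    (toFinite {T' | T' ⊆ S ∧ (B.region q T' ∩ F).Nonempty}).exists_maximal
      ⟨∅, empty_subset _, by simpa [region] using hne⟩
  have hsub : B.region q T' ⊆ F := by
    refine (hB.isPreconnected_region q T').subset_of_closure_inter_subset hF hT'ne ?_
    rintro x ⟨hx, hxT'⟩
    by_contra hxF
    obtain ⟨T, hTS, ⟨t, htT, htq, ht⟩, hev⟩ := hloc x ⟨hx, by rwa [hF.interior_eq]⟩
    have htT' : t ∉ T' := fun h => ht (mem_region_iff.1 hxT' t h htq)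
    obtain ⟨y, ⟨hyT, hyT'⟩, hyF⟩ := mem_closure_iff_nhds.1 hx _
      (Filter.inter_mem hev ((isOpen_region q T').mem_nhds hxT'))
    refine htT' (hmax (y := insert t T') ⟨insert_subset (hTS htT) hT'S, y, ?_, hyF⟩
      (subset_insert _ _) (mem_insert _ _))
    rw [mem_region_iff] at hyT' ⊢
    rintro r (rfl | hr) hrq
    · exact mem_region_iff.1 (hyT.1 hyF) r htT hrq
    · exact hyT' r hr hrq
  exact (biInter_subset_biInter_left (sdiff_subset_sdiff_left hT'S)).trans hsub

/-- A closed set `G` that coincides, near each of its points `x`, with the Voronoi diagram of a set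
`T x` of sites that are all tied at `x` and have regions accumulating at `x`. The values of `T`
outside of `G` are irrelevant. Relatively clopen subsets inherit this structure. -/
structure IsLocalDiagram (B : BisectorSystem ι) (G : Set Plane) (T : Plane → Set ι) : Prop where
  isClosed : IsClosed G
  nontrivial : ∀ x ∈ G, (T x).Nontrivial
  tie : ∀ x ∈ G, ∀ p ∈ T x, ∀ q ∈ T x, ¬ B.Beats x p q
  mem_closure : ∀ x ∈ G, ∀ p ∈ T x, x ∈ closure (B.region p (T x))
  eventually : ∀ x ∈ G, ∀ᶠ y in 𝓝 x,
    (y ∈ G ↔ y ∈ B.diagram (T x)) ∧ (y ∈ G → T y = B.top y (T x))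

/-- An assignment of sites to the faces of `G` (a locally constant function off `G`) which near each
point of `G` is the one of the local Voronoi diagram. -/
structure IsLabelling (B : BisectorSystem ι) (G : Set Plane) (T : Plane → Set ι) (l : Plane → ι) :
    Prop where
  eventually_eq : ∀ y ∉ G, ∀ᶠ z in 𝓝 y, l z = l y
  eventually_mem : ∀ x ∈ G, ∀ᶠ y in 𝓝 x, y ∉ G → l y ∈ T x ∧ y ∈ B.region (l y) (T x)

variable {G : Set Plane} {T : Plane → Set ι} {l : Plane → ι}

/-- The sites that occur in the local diagrams of `G`. -/
def relevant (G : Set Plane) (T : Plane → Set ι) : Set ι := ⋃ x ∈ G, T x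

theorem mem_relevant {x : Plane} {p : ι} (hx : x ∈ G) (hp : p ∈ T x) : p ∈ relevant G T :=
  mem_iUnion₂.2 ⟨x, hx, hp⟩

namespace IsLabelling

theorem eventually_region (hG : B.IsLocalDiagram G T) (hl : B.IsLabelling G T l) {x : Plane}
    (hx : x ∈ G) {p : ι} (hp : p ∈ T x) :
    ∀ᶠ y in 𝓝 x, y ∈ B.region p (T x) ↔ y ∉ G ∧ l y = p := by
  filter_upwards [hG.eventually x hx, hl.eventually_mem x hx] with y hy hy'
  constructor
  · intro h
    have hyG : y ∉ G := by rw [hy.1, notMem_diagram_iff]; exact ⟨p, hp, h⟩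
    refine ⟨hyG, ?_⟩
    by_contra hne
    exact disjoint_left.1 (disjoint_region (hy' hyG).1 hp hne) (hy' hyG).2 h
  · rintro ⟨h, rfl⟩
    exact (hy' h).2

/-- All labels are relevant, as the points with an irrelevant label form a clopen subset of the
plane. -/
theorem mem_relevant (hG : B.IsLocalDiagram G T) (hl : B.IsLabelling G T l) (hne : G.Nonempty)
    {y : Plane} (hy : y ∉ G) : l y ∈ relevant G T := by
  set A : Set Plane := {y | y ∉ G ∧ l y ∉ relevant G T} with hA
  have hopen : IsOpen A := by
    rw [isOpen_iff_mem_nhds]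
    rintro y ⟨hy, hly⟩
    filter_upwards [hG.isClosed.isOpen_compl.mem_nhds hy, hl.eventually_eq y hy] with z hz hz'
    exact ⟨hz, hz' ▸ hly⟩
  have hclosed : IsClosed A := by
    rw [← isOpen_compl_iff, isOpen_iff_mem_nhds]
    intro y hyA
    by_cases hy : y ∈ G
    · filter_upwards [hl.eventually_mem y hy] with z hz hzA
      exact hzA.2 (BisectorSystem.mem_relevant hy (hz hzA.1).1)
    · filter_upwards [hl.eventually_eq y hy] with z hz hzA
      exact hyA ⟨hy, hz ▸ hzA.2⟩
  by_contra hly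
  obtain ⟨x, hx⟩ := hne
  rcases isClopen_iff.1 ⟨hclosed, hopen⟩ with h | h
  · exact (h ▸ (⟨hy, hly⟩ : y ∈ A) : y ∈ (∅ : Set Plane))
  · exact (h ▸ mem_univ x : x ∈ A).1 hx

/-- The faces labelled `q` are locally Voronoi regions of `q`, so their union contains the region
of `q`. -/
theorem region_subset_face [Finite ι] (hB : B.Admissible) (hG : B.IsLocalDiagram G T)
    (hl : B.IsLabelling G T l) {q : ι} (hq : q ∈ relevant G T) :
    B.region q (relevant G T) ⊆ {y | y ∉ G ∧ l y = q} := by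
  have hopen : IsOpen {y | y ∉ G ∧ l y = q} := by
    rw [isOpen_iff_mem_nhds]
    rintro y ⟨hy, hly⟩
    filter_upwards [hG.isClosed.isOpen_compl.mem_nhds hy, hl.eventually_eq y hy] with z hz hz'
    exact ⟨hz, hz'.trans hly⟩
  refine hB.region_subset_of_locally_region hopen ?_ ?_
  · obtain ⟨x, hx, hqx⟩ := mem_iUnion₂.1 hq
    obtain ⟨y, hy, hy'⟩ := mem_closure_iff_nhds.1 (hG.mem_closure x hx q hqx) _
      (hl.eventually_region hG hx hqx)
    exact ⟨y, hy.1 hy'⟩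
  · intro x hx
    have hxF := hx.2
    rw [hopen.interior_eq] at hxF
    have hxG : x ∈ G := by
      by_contra hxG
      obtain ⟨y, hy, hy'⟩ := mem_closure_iff_nhds.1 hx.1 _ (hl.eventually_eq x hxG)
      exact hxF ⟨hxG, hy.symm.trans hy'.2⟩
    have hqx : q ∈ T x := by
      obtain ⟨y, hy, hyG, rfl⟩ := mem_closure_iff_nhds.1 hx.1 _ (hl.eventually_mem x hxG)
      exact (hy hyG).1
    obtain ⟨t, ht, htq⟩ := (hG.nontrivial x hxG).exists_ne q
    exact ⟨T x, fun p hp => BisectorSystem.mem_relevant hxG hp,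
      ⟨t, ht, htq, hG.tie x hxG q hqx t ht⟩,
      (hl.eventually_region hG hxG hqx).mono fun y hy => hy.symm⟩

/-- The points at which `q` is preferred to the present owners: to the label off `G`, and to the
locally relevant sites on `G`. -/
def conquest (B : BisectorSystem ι) (G : Set Plane) (T : Plane → Set ι) (l : Plane → ι) (q : ι) :
    Set Plane :=
  {y | (y ∉ G → B.Beats y q (l y)) ∧ (y ∈ G → ∀ t ∈ T y, B.Beats y q t)}

/-- The points won by a relevant site `q` form a set that is locally a Voronoi region of `q`, too.
If it were not empty, it would contain the region of `q`, which already lies in the faces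
labelled `q`. -/
theorem conquest_eq_empty [Finite ι] (hB : B.Admissible) (hG : B.IsLocalDiagram G T)
    (hl : B.IsLabelling G T l) {q : ι} (hq : q ∈ relevant G T) :
    conquest B G T l q = ∅ := by
  have hGne : G.Nonempty := by
    obtain ⟨x, hx, -⟩ := mem_iUnion₂.1 hq
    exact ⟨x, hx⟩
  have hopen : IsOpen (conquest B G T l q) := by
    rw [isOpen_iff_mem_nhds]
    intro x hx
    by_cases hxG : x ∈ G
    · filter_upwards [hG.eventually x hxG, hl.eventually_mem x hxG,
        (Filter.eventually_all_finite (toFinite (T x))).2 fun t ht =>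
          (isOpen_beats q t).mem_nhds (hx.2 hxG t ht)] with z hz hz' hz''
      exact ⟨fun h => hz'' _ (hz' h).1, fun h t ht => hz'' t ((hz.2 h ▸ ht :)).1⟩
    · filter_upwards [hG.isClosed.isOpen_compl.mem_nhds hxG, hl.eventually_eq x hxG,
        (isOpen_beats q (l x)).mem_nhds (hx.1 hxG)] with z hz hz' hz''
      exact ⟨fun _ => hz' ▸ hz'', fun h => absurd h hz⟩
  by_contra hne
  rw [← ne_eq, ← nonempty_iff_ne_empty] at hne
  suffices hsub : B.region q (relevant G T) ⊆ conquest B G T l q by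
    obtain ⟨y, hy⟩ := (hB.regions _ q hq).1
    obtain ⟨hyG, hly⟩ := hl.region_subset_face hB hG hq hy
    exact beats_irrefl y q (by simpa [hly] using (hsub hy).1 hyG)
  refine hB.region_subset_of_locally_region hopen hne fun x hx => ?_
  have hxW := hx.2
  rw [hopen.interior_eq] at hxW
  -- the bounding sites are the locally relevant ones on `G`, and the label of the face off `G`
  by_cases hxG : x ∈ G
  · refine ⟨T x, fun p hp => BisectorSystem.mem_relevant hxG hp, ?_, ?_⟩
    all_goals
      -- near `x`, a locally relevant site is nowhere preferred to the best one of them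
      have hqx : q ∉ T x := by
        intro hqx
        obtain ⟨z, ⟨hz, hz'⟩, hzW⟩ := mem_closure_iff_nhds.1 hx.1 _
          (Filter.inter_mem (hG.eventually x hxG) (hl.eventually_mem x hxG))
        by_cases hzG : z ∈ G
        · obtain ⟨t, ht⟩ := hB.top_nonempty z (hG.nontrivial x hxG).nonempty
          exact ht.2 q hqx (hzW.2 hzG t (hz.2 hzG ▸ ht))
        · have h := hzW.1 hzG
          exact h.asymm (mem_region_iff.1 (hz' hzG).2 q hqx h.1)
    · by_contra! h
      exact hxW ⟨fun h => absurd hxG h, fun _ t ht => h t ht (ne_of_mem_of_not_mem ht hqx)⟩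
    · filter_upwards [hG.eventually x hxG, hl.eventually_mem x hxG] with z hz hz'
      rw [mem_region_iff]
      constructor
      · intro hzW t ht _
        by_cases hzG : z ∈ G
        · obtain ⟨p, hp⟩ := hB.top_nonempty z (hG.nontrivial x hxG).nonempty
          exact (hB.beats_or (hzW.2 hzG p (hz.2 hzG ▸ hp)) t).resolve_right (hp.2 t ht)
        · by_cases hlt : t = l z
          · exact hlt ▸ hzW.1 hzG
          · exact hB.beats_trans (hzW.1 hzG) (mem_region_iff.1 (hz' hzG).2 t ht hlt)
      · intro h
        refine ⟨fun hzG => h _ (hz' hzG).1 (ne_of_mem_of_not_mem (hz' hzG).1 hqx),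
          fun hzG t ht => ?_⟩
        rw [hz.2 hzG] at ht
        exact h t ht.1 (ne_of_mem_of_not_mem ht.1 hqx)
  · have hlx : l x ≠ q := by
      obtain ⟨z, ⟨hz, hz'⟩, hzW⟩ := mem_closure_iff_nhds.1 hx.1 _
        (Filter.inter_mem (hG.isClosed.isOpen_compl.mem_nhds hxG) (hl.eventually_eq x hxG))
      have := hzW.1 hz
      rw [show l z = l x from hz'] at this
      exact this.1.symm
    refine ⟨{l x}, singleton_subset_iff.2 (hl.mem_relevant hG hGne hxG), ⟨l x, rfl, hlx, ?_⟩, ?_⟩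
    · exact fun h => hxW ⟨fun _ => h, fun h' => absurd h' hxG⟩
    · filter_upwards [hG.isClosed.isOpen_compl.mem_nhds hxG, hl.eventually_eq x hxG] with z hz hz'
      simp only [mem_region_iff, mem_singleton_iff, forall_eq]
      exact ⟨fun h _ => hz' ▸ h.1 hz, fun h => ⟨fun _ => hz'.symm ▸ h hlx, fun h' => absurd h' hz⟩⟩

theorem mem_region_of_notMem [Finite ι] (hB : B.Admissible) (hG : B.IsLocalDiagram G T)
    (hl : B.IsLabelling G T l) {y : Plane} (hy : y ∉ G) :
    y ∈ B.region (l y) (relevant G T) := by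
  rw [mem_region_iff]
  intro q hq hqy
  have hW := hl.conquest_eq_empty hB hG hq
  by_contra h
  have hy' : y ∈ B.bis q (l y) := (mem_bis_iff hqy).2
    ⟨fun h' => (hW ▸ (⟨fun _ => h', fun h => absurd h hy⟩ : y ∈ conquest B G T l q) :
      y ∈ (∅ : Set Plane)), h⟩
  obtain ⟨z, ⟨hz, hz'⟩, hzd⟩ := mem_closure_iff_nhds.1 (mem_closure_dom hqy hy') _
    (Filter.inter_mem (hG.isClosed.isOpen_compl.mem_nhds hy) (hl.eventually_eq y hy))
  have hzW : z ∈ conquest B G T l q :=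
    ⟨fun _ => show B.Beats z q (l z) from (show l z = l y from hz').symm ▸ ⟨hqy, hzd⟩,
      fun h => absurd h hz⟩
  exact (hW ▸ hzW : z ∈ (∅ : Set Plane))

/-- Local diagrams that admit a labelling are Voronoi diagrams. -/
theorem eq_diagram [Finite ι] (hB : B.Admissible) (hG : B.IsLocalDiagram G T)
    (hl : B.IsLabelling G T l) (hne : G.Nonempty) : G = B.diagram (relevant G T) := by
  ext y
  constructor
  · intro hy
    by_contra h
    obtain ⟨p, hp, hyp⟩ := notMem_diagram_iff.1 h
    obtain ⟨a, ha, hap⟩ := (hG.nontrivial y hy).exists_ne p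
    obtain ⟨z, ⟨hz, hz'⟩, hza⟩ := mem_closure_iff_nhds.1 (hG.mem_closure y hy a ha) _
      (Filter.inter_mem (hl.eventually_region hG hy ha) ((isOpen_region p _).mem_nhds hyp))
    obtain ⟨hzG, rfl⟩ := hz.1 hza
    exact disjoint_left.1 (disjoint_region hp (hl.mem_relevant hG hne hzG) hap.symm) hz'
      (hl.mem_region_of_notMem hB hG hzG)
  · intro hy
    by_contra h
    exact notMem_diagram_iff.2 ⟨l y, hl.mem_relevant hG hne h, hl.mem_region_of_notMem hB hG h⟩ hy

theorem mem_closure_region_iff [Finite ι] (hB : B.Admissible) (hG : B.IsLocalDiagram G T)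
    (hl : B.IsLabelling G T l) {x : Plane} (hx : x ∈ G) {p : ι} (hp : p ∈ relevant G T) :
    x ∈ closure (B.region p (relevant G T)) ↔ p ∈ T x := by
  constructor
  · intro h
    obtain ⟨z, hz, hzp⟩ := mem_closure_iff_nhds.1 h _ (hl.eventually_mem x hx)
    obtain ⟨hzG, rfl⟩ := hl.region_subset_face hB hG hp hzp
    exact (hz hzG).1
  · intro h
    rw [mem_closure_iff_nhds]
    intro N hN
    obtain ⟨z, ⟨hz, hzN⟩, hzp⟩ := mem_closure_iff_nhds.1 (hG.mem_closure x hx p h) _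
      (Filter.inter_mem (hl.eventually_region hG hx h) hN)
    obtain ⟨hzG, rfl⟩ := hz.1 hzp
    exact ⟨z, hzN, hl.mem_region_of_notMem hB hG hzG⟩

end IsLabelling
end BisectorSystem

/-! ### Existence of a labelling -/

namespace BisectorSystem
variable {ι : Type*} {B : BisectorSystem ι} {G : Set Plane} {T : Plane → Set ι}

open Metric

/-- The labels of the local diagrams at different points of `G` agree on overlaps of small balls. -/
theorem IsLocalDiagram.exists_near_label [Finite ι] [Nonempty ι] (hB : B.Admissible)
    (hG : B.IsLocalDiagram G T) :
    ∃ (r : Plane → ℝ) (m : Plane → ι), (∀ x ∈ G, 0 < r x) ∧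
      ∀ x ∈ G, ∀ y ∈ ball x (r x), y ∉ G → m y ∈ T x ∧ y ∈ B.region (m y) (T x) := by
  classical
  have hex : ∀ x ∈ G, ∃ r > 0, ∀ y ∈ ball x r,
      ((y ∈ G ↔ y ∈ B.diagram (T x)) ∧ (y ∈ G → T y = B.top y (T x))) ∧
      ∀ p q, B.Beats x p q → B.Beats y p q := by
    intro x hx
    have h : ∀ᶠ y in 𝓝 x, ∀ p q, B.Beats x p q → B.Beats y p q := by
      simp only [Filter.eventually_all]
      exact fun p q h => (isOpen_beats p q).mem_nhds h
    obtain ⟨r, hr, hr'⟩ := Metric.mem_nhds_iff.1 (Filter.inter_mem (hG.eventually x hx) h)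
    exact ⟨r, hr, hr'⟩
  choose! ρ hρ hloc using hex
  have hlabel : ∀ x ∈ G, ∀ y ∈ ball x (ρ x), y ∉ G → ∃ p ∈ T x, y ∈ B.region p (T x) := by
    intro x hx y hy hyG
    rwa [(hloc x hx y hy).1.1, notMem_diagram_iff] at hyG
  -- the label of the smaller of two overlapping half-size balls is the label of the larger one,
  -- as the centre of the smaller one lies in the (full) larger one
  have hcomp : ∀ x ∈ G, ∀ x' ∈ G, ρ x' ≤ ρ x → ∀ y ∈ ball x (ρ x / 2), y ∈ ball x' (ρ x' / 2) →
      ∀ p' ∈ T x', y ∈ B.region p' (T x') → p' ∈ T x ∧ y ∈ B.region p' (T x) := by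
    intro x hx x' hx' hle y hy hy' p' hp' hyp'
    have hxx' : x' ∈ ball x (ρ x) := by
      rw [mem_ball] at *
      have := dist_triangle x' y x
      rw [dist_comm x' y] at this
      linarith
    have hT := (hloc x hx x' hxx').1.2 hx'
    have hyb : y ∈ ball x' (ρ x') := ball_subset_ball (by linarith [hρ x' hx']) hy'
    rw [hT] at hp' hyp'
    refine ⟨hp'.1, mem_region_iff.2 fun t ht htp => ?_⟩
    by_cases htop : t ∈ B.top x' (T x)
    · exact mem_region_iff.1 hyp' t htop htp
    · have : ∃ q ∈ T x, B.Beats x' q t := by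
        by_contra! h
        exact htop ⟨ht, h⟩
      obtain ⟨q, hq, hqt⟩ := this
      exact (hloc x' hx' y hyb).2 _ _ ((hB.beats_or hqt p').resolve_left (hp'.2 q hq))
  have hhalf : ∀ x ∈ G, ball x (ρ x / 2) ⊆ ball x (ρ x) := fun x hx =>
    ball_subset_ball (by linarith [hρ x hx])
  refine ⟨fun x => ρ x / 2, fun y => if h : ∃ x ∈ G, y ∈ ball x (ρ x / 2) ∧
    ∃ p ∈ T x, y ∈ B.region p (T x) then h.choose_spec.2.2.choose else Classical.arbitrary ι,
    fun x hx => half_pos (hρ x hx), ?_⟩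
  intro x hx y hy hyG
  obtain ⟨p, hp, hyp⟩ := hlabel x hx y (hhalf x hx hy) hyG
  have h : ∃ x ∈ G, y ∈ ball x (ρ x / 2) ∧ ∃ p ∈ T x, y ∈ B.region p (T x) :=
    ⟨x, hx, hy, p, hp, hyp⟩
  simp only [dif_pos h]
  obtain ⟨hx', hy', hex'⟩ := h.choose_spec
  have hp' := hex'.choose_spec
  rcases le_total (ρ h.choose) (ρ x) with hle | hle
  · exact hcomp x hx _ hx' hle y hy hy' _ hp'.1 hp'.2
  · obtain ⟨h₁, h₂⟩ := hcomp _ hx' x hx hle y hy' hy p hp hyp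
    have heq : p = hex'.choose := by
      by_contra hne
      exact disjoint_left.1 (disjoint_region h₁ hp'.1 hne) h₂ hp'.2
    rw [← heq]
    exact ⟨hp, hyp⟩

/-- The label near `G`, encoded by `e` as an integer, is the difference of a function `a` that is
locally constant near `G` and a function `b` that is locally constant off `G`. -/
structure IsSplitting (B : BisectorSystem ι) (G : Set Plane) (T : Plane → Set ι) (e : ι → ℤ)
    (a b : Plane → ℤ) : Prop where
  eventually_left : ∀ x ∈ G, ∀ᶠ y in 𝓝 x, a y = a x
  eventually_right : ∀ y ∉ G, ∀ᶠ z in 𝓝 y, b z = b y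
  label : ∀ x ∈ G, ∀ᶠ y in 𝓝 x, y ∉ G → ∃ p ∈ T x, y ∈ B.region p (T x) ∧ e p = a y - b y

theorem IsLocalDiagram.exists_splitting [Finite ι] [Nonempty ι] (hB : B.Admissible)
    (hG : B.IsLocalDiagram G T) (e : ι → ℤ) : ∃ a b, IsSplitting B G T e a b := by
  obtain ⟨r, m, hr, hm⟩ := hG.exists_near_label hB
  set N : Set Plane := ⋃ x ∈ G, ball x (r x)
  have hN : IsOpen N := isOpen_biUnion fun _ _ => isOpen_ball
  have hGN : G ⊆ N := fun x hx => mem_biUnion hx (mem_ball_self (hr x hx))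
  have hm' : ContinuousOn (fun y => e (m y)) (N ∩ Gᶜ) := by
    refine continuousOn_of_eventually_eq ?_
    rintro y ⟨hy, hyG⟩
    obtain ⟨x, hx, hyx⟩ := mem_iUnion₂.1 hy
    obtain ⟨h₁, h₂⟩ := hm x hx y hyx hyG
    filter_upwards [isOpen_ball.mem_nhds hyx, hG.isClosed.isOpen_compl.mem_nhds hyG,
      (isOpen_region _ _).mem_nhds h₂] with z hz hzG hz'
    obtain ⟨h₃, h₄⟩ := hm x hx z hz hzG
    by_contra hne
    exact disjoint_left.1 (disjoint_region h₃ h₁ fun h => hne (congrArg e h)) h₄ hz'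
  obtain ⟨a, b, ha, hb, hab⟩ := exists_int_splitting hN hG.isClosed.isOpen_compl
    (eq_univ_of_forall fun x => (em (x ∈ G)).imp (fun h => hGN h) id) hm'
  refine ⟨a, b, fun x hx => eventually_eq_of_continuousOn ha hN (hGN hx),
    fun y hy => eventually_eq_of_continuousOn hb hG.isClosed.isOpen_compl hy, fun x hx => ?_⟩
  filter_upwards [isOpen_ball.mem_nhds (mem_ball_self (hr x hx))] with y hy hyG
  obtain ⟨h₁, h₂⟩ := hm x hx y hy hyG
  exact ⟨m y, h₁, h₂, hab y ⟨mem_biUnion hx hy, hyG⟩⟩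

/-- If the first part of the splitting is constant on `G`, then the second part extends the labels
near `G` to whole faces. -/
theorem IsSplitting.exists_labelling [Nonempty ι] {e : ι → ℤ} (he : Function.Injective e)
    {a b : Plane → ℤ} (h : IsSplitting B G T e a b) {k : ℤ} (hk : ∀ x ∈ G, a x = k) :
    ∃ l, B.IsLabelling G T l := by
  refine ⟨fun y => Function.invFun e (k - b y), fun y hy => ?_, fun x hx => ?_⟩
  · filter_upwards [h.eventually_right y hy] with z hz
    rw [hz]
  · filter_upwards [h.label x hx, h.eventually_left x hx] with y hy hy' hyG
    obtain ⟨p, hp, hyp, hep⟩ := hy hyG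
    rw [← hk x hx, ← hy', ← hep, Function.leftInverse_invFun he p]
    exact ⟨hp, hyp⟩

theorem exists_injective_int [Finite ι] : ∃ e : ι → ℤ, Function.Injective e := by
  obtain ⟨n, ⟨f⟩⟩ := Finite.exists_equiv_fin ι
  exact ⟨fun i => (f i : ℕ), fun i j h => f.injective (Fin.ext (Int.ofNat.inj h))⟩

theorem IsLocalDiagram.exists_labelling_of_isPreconnected [Finite ι] [Nonempty ι]
    (hB : B.Admissible) (hG : B.IsLocalDiagram G T) (hc : IsPreconnected G) :
    ∃ l, B.IsLabelling G T l := by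
  obtain ⟨e, he⟩ := exists_injective_int (ι := ι)
  obtain ⟨a, b, hab⟩ := hG.exists_splitting hB e
  rcases G.eq_empty_or_nonempty with h | ⟨x₀, hx₀⟩
  · exact hab.exists_labelling he (k := 0) (by simp [h])
  · exact hab.exists_labelling he fun x hx =>
      eq_of_isPreconnected_of_eventually_eq hc hab.eventually_left hx hx₀

theorem one_lt_rank_plane : 1 < Module.rank ℝ Plane := by
  rw [← Module.finrank_eq_rank, finrank_euclideanSpace_fin]; norm_num

theorem Admissible.not_bis_subset_closedBall (hB : B.Admissible) {p q : ι} (hpq : p ≠ q) (R : ℝ) :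
    ¬ B.bis p q ⊆ closedBall 0 R := by
  intro h
  obtain ⟨γ, hγ, hr⟩ := hB.curve p q hpq
  have := hγ.isCompact_preimage (isCompact_closedBall (0 : Plane) R)
  rw [preimage_eq_univ_iff.2 (hr ▸ h)] at this
  exact noncompact_univ ℝ this

/-- A connected local diagram is a Voronoi diagram. If it were bounded, a single region would fill
the complement of a disk, which the unbounded bisectors of its site meet. -/
theorem IsLocalDiagram.not_isBounded [Finite ι] (hB : B.Admissible) (hG : B.IsLocalDiagram G T)
    (hc : IsConnected G) : ¬ Bornology.IsBounded G := by
  intro hb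
  obtain ⟨x, hx⟩ := hc.nonempty
  obtain ⟨p₀, hp₀, q₀, hq₀, hpq₀⟩ := hG.nontrivial x hx
  have : Nonempty ι := ⟨p₀⟩
  obtain ⟨l, hl⟩ := hG.exists_labelling_of_isPreconnected hB hc.isPreconnected
  obtain ⟨R₀, hR₀⟩ := hb.subset_closedBall 0
  obtain ⟨R, hR, hGR⟩ : ∃ R, 0 ≤ R ∧ G ⊆ closedBall 0 R :=
    ⟨max R₀ 0, le_max_right _ _, hR₀.trans (closedBall_subset_closedBall (le_max_left _ _))⟩
  obtain ⟨y₀, -, hy₀⟩ := not_subset.1 (hB.not_bis_subset_closedBall hpq₀ R)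
  obtain ⟨q, hq, hqp⟩ := (hG.nontrivial x hx).exists_ne (l y₀)
  refine hB.not_bis_subset_closedBall hqp R fun y hy => ?_
  by_contra hyR
  have hyl : l y = l y₀ := eq_of_isPreconnected_of_eventually_eq
    (isPreconnected_compl_closedBall one_lt_rank_plane hR)
    (fun z hz => hl.eventually_eq z fun h => hz (hGR h)) hyR hy₀
  have hreg := hl.mem_region_of_notMem hB hG fun h => hyR (hGR h)
  rw [hyl] at hreg
  exact ((mem_bis_iff hqp).1 hy).2 (mem_region_iff.1 hreg q (BisectorSystem.mem_relevant hx hq) hqp)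

theorem IsLocalDiagram.of_isClosed_diff (hG : B.IsLocalDiagram G T) {C : Set Plane} (hCG : C ⊆ G)
    (hC : IsClosed C) (hGC : IsClosed (G \ C)) : B.IsLocalDiagram C T where
  isClosed := hC
  nontrivial x hx := hG.nontrivial x (hCG hx)
  tie x hx := hG.tie x (hCG hx)
  mem_closure x hx := hG.mem_closure x (hCG hx)
  eventually x hx := by
    filter_upwards [hG.eventually x (hCG hx), hGC.isOpen_compl.mem_nhds fun h => h.2 hx]
      with y hy hy'
    have : y ∈ C ↔ y ∈ G := ⟨fun h => hCG h, fun h => by_contra fun h' => hy' ⟨h, h'⟩⟩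
    rwa [this]

/-- A labelling outside of a disk can be extended to a labelling of all faces, if `G` is a union of
finitely many connected sets: the first part of the splitting is then constant outside of the
disk, and each of its level sets in `G` has points there, as the components of `G` are unbounded. -/
theorem IsLocalDiagram.exists_labelling_of_outside [Finite ι] [Nonempty ι] (hB : B.Admissible)
    (hG : B.IsLocalDiagram G T) {κ : Type*} [Finite κ] {A : κ → Set Plane}
    (hA : ∀ i, IsPreconnected (A i)) (hGA : G = ⋃ i, A i) {R : ℝ} (hR : 0 ≤ R) {c : Plane → ι}
    (hc : ∀ y ∉ closedBall 0 R ∪ G, ∀ᶠ z in 𝓝 y, c z = c y)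
    (hcT : ∀ x ∈ G, x ∉ closedBall 0 R → ∀ᶠ y in 𝓝 x, y ∉ G →
      c y ∈ T x ∧ y ∈ B.region (c y) (T x)) :
    ∃ l, B.IsLabelling G T l := by
  classical
  obtain ⟨e, he⟩ := exists_injective_int (ι := ι)
  obtain ⟨a, b, hab⟩ := hG.exists_splitting hB e
  -- `a` extends to a locally constant function outside of the disk
  set f : Plane → ℤ := fun y => if y ∈ G then a y else e (c y) + b y with hf
  have hloc : ∀ y ∈ (closedBall (0 : Plane) R)ᶜ, ∀ᶠ z in 𝓝 y, f z = f y := by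
    intro y hy
    by_cases hyG : y ∈ G
    · filter_upwards [hab.eventually_left y hyG, hab.label y hyG, hcT y hyG hy] with z h₁ h₂ h₃
      simp only [hf, if_pos hyG]
      split_ifs with hzG
      · exact h₁
      · obtain ⟨p, hp, hzp, hep⟩ := h₂ hzG
        obtain ⟨h₄, h₅⟩ := h₃ hzG
        have : p = c z := by
          by_contra hne
          exact disjoint_left.1 (disjoint_region hp h₄ hne) hzp h₅
        rw [← this, hep, h₁]; ring
    · filter_upwards [hG.isClosed.isOpen_compl.mem_nhds hyG, hab.eventually_right y hyG,
        hc y (by simp only [mem_union, not_or]; exact ⟨hy, hyG⟩)] with z hz h₁ h₂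
      simp only [hf, if_neg hyG, if_neg (show z ∉ G from hz), h₁, h₂]
  -- every level set of `a` on `G` is unbounded
  have hout : ∀ x ∈ G, ∃ y ∈ G, y ∉ closedBall (0 : Plane) R ∧ a y = a x := by
    intro x hx
    have hclosed : ∀ M : Set ℤ, IsClosed (G ∩ a ⁻¹' M) := fun M =>
      (continuousOn_of_eventually_eq hab.eventually_left).preimage_isClosed_of_isClosed hG.isClosed
        (isClosed_discrete M)
    obtain ⟨D, hDC, hD, hGD, hDc⟩ := exists_isConnected_isClosed_diff hA hGA
      (C := G ∩ a ⁻¹' {a x}) inter_subset_left (hclosed _)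
      (by rw [sdiff_self_inter, sdiff_eq, ← preimage_compl]; exact hclosed _) ⟨x, hx, rfl⟩
    have hDG := hDC.trans inter_subset_left
    have := (hG.of_isClosed_diff hDG hD hGD).not_isBounded hB hDc
    obtain ⟨y, hy, hyR⟩ := not_subset.1 fun h => this (isBounded_closedBall.subset h)
    exact ⟨y, hDG hy, hyR, (hDC hy).2⟩
  have hconst : ∀ x ∈ G, ∀ x' ∈ G, a x = a x' := by
    intro x hx x' hx'
    obtain ⟨y, hy, hyR, h₁⟩ := hout x hx
    obtain ⟨y', hy', hyR', h₂⟩ := hout x' hx'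
    have := eq_of_isPreconnected_of_eventually_eq
      (isPreconnected_compl_closedBall one_lt_rank_plane hR) hloc hyR hyR'
    simp only [hf, if_pos hy, if_pos hy'] at this
    rw [← h₁, ← h₂, this]
  rcases G.eq_empty_or_nonempty with h | ⟨x₀, hx₀⟩
  · exact hab.exists_labelling he (k := 0) (by simp [h])
  · exact hab.exists_labelling he fun x hx => hconst x hx x₀ hx₀

end BisectorSystem

/-! ### The local structure of arrangement graphs -/

namespace BisectorSystem
variable {ι : Type*} {B : BisectorSystem ι}

/-- Components of a bisector minus a closed set are relatively open. -/
theorem Admissible.eventually_mem_component (hB : B.Admissible) {p q : ι} (hpq : p ≠ q)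
    {Z : Set Plane} (hZ : IsClosed Z) {x : Plane} (hx : x ∈ B.bis p q \ Z) :
    ∀ᶠ y in 𝓝 x, y ∈ B.bis p q → y ∈ connectedComponentIn (B.bis p q \ Z) x := by
  obtain ⟨γ, hγ, hr⟩ := hB.curve p q hpq
  obtain ⟨t, rfl⟩ : x ∈ range γ := hr ▸ hx.1
  obtain ⟨ε, hε, hεZ⟩ := Metric.isOpen_iff.1 (hZ.preimage hγ.continuous).isOpen_compl t hx.2
  have hsub : γ '' Metric.ball t ε ⊆ connectedComponentIn (B.bis p q \ Z) (γ t) := by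
    refine (Metric.isPreconnected_ball.image γ
      hγ.continuous.continuousOn).subset_connectedComponentIn
      (mem_image_of_mem γ (Metric.mem_ball_self hε)) ?_
    rintro _ ⟨u, hu, rfl⟩
    exact ⟨hr ▸ mem_range_self u, hεZ hu⟩
  have hball := Metric.ball_mem_nhds t hε
  rw [hγ.isInducing.nhds_eq_comap] at hball
  obtain ⟨U, hU, hUb⟩ := hball
  filter_upwards [hU] with y hy hyJ
  obtain ⟨u, rfl⟩ : y ∈ range γ := hr ▸ hyJ
  exact hsub (mem_image_of_mem γ (hUb hy))

theorem Admissible.finite_components (hB : B.Admissible) {p q : ι} (hpq : p ≠ q)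
    {Z : Set Plane} (hZ : Z.Finite) :
    {α | ∃ x ∈ B.bis p q \ Z, α = connectedComponentIn (B.bis p q \ Z) x}.Finite := by
  obtain ⟨γ, hγ, hr⟩ := hB.curve p q hpq
  have hfin : (γ ⁻¹' Z).Finite := hZ.preimage hγ.injective.injOn
  -- a component is determined by the set of removed parameters below it
  have hkey : ∀ t u, γ t ∉ Z → {z ∈ γ ⁻¹' Z | z < t} = {z ∈ γ ⁻¹' Z | z < u} → t ≤ u →
      γ u ∉ Z → connectedComponentIn (B.bis p q \ Z) (γ t) =
        connectedComponentIn (B.bis p q \ Z) (γ u) := by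
    intro t u ht htu hle hu
    refine connectedComponentIn_eq ((isPreconnected_Icc.image γ
      hγ.continuous.continuousOn).subset_connectedComponentIn
      (mem_image_of_mem γ (left_mem_Icc.2 hle)) ?_ (mem_image_of_mem γ (right_mem_Icc.2 hle)))
    rintro _ ⟨z, hz, rfl⟩
    refine ⟨hr ▸ mem_range_self z, fun hzZ => ?_⟩
    have hzu : z < u := lt_of_le_of_ne hz.2 (by rintro rfl; exact hu hzZ)
    have : z ∈ {z ∈ γ ⁻¹' Z | z < t} := htu ▸ ⟨hzZ, hzu⟩
    exact absurd this.2 (not_lt.2 hz.1)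
  have hmaps : ∀ α ∈ {α | ∃ x ∈ B.bis p q \ Z, α = connectedComponentIn (B.bis p q \ Z) x},
      ∃ t, γ t ∉ Z ∧ α = connectedComponentIn (B.bis p q \ Z) (γ t) := by
    rintro α ⟨x, hx, rfl⟩
    obtain ⟨t, rfl⟩ : x ∈ range γ := hr ▸ hx.1
    exact ⟨t, hx.2, rfl⟩
  choose! τ hτZ hτ using hmaps
  refine Finite.of_finite_image (f := fun α => {z ∈ γ ⁻¹' Z | z < τ α})
    (hfin.finite_subsets.subset ?_) ?_
  · rintro _ ⟨α, -, rfl⟩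
    exact sep_subset _ _
  · intro α hα β hβ heq
    rcases le_total (τ α) (τ β) with h | h
    · rw [hτ α hα, hτ β hβ]
      exact hkey _ _ (hτZ α hα) heq h (hτZ β hβ)
    · rw [hτ α hα, hτ β hβ]
      exact (hkey _ _ (hτZ β hβ) heq.symm h (hτZ α hα)).symm

theorem Admissible.finite_arrangementVertices [Finite ι] (hB : B.Admissible) :
    {v | B.IsArrangementVertex v}.Finite := by
  have : {v | B.IsArrangementVertex v} ⊆ ⋃ p, ⋃ q, ⋃ r, ⋃ s,
      {v | p ≠ q ∧ r ≠ s ∧ s(p, q) ≠ s(r, s) ∧ v ∈ B.bis p q ∩ B.bis r s} := by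
    rintro v ⟨p, q, r, s, h⟩
    simp only [mem_iUnion]
    exact ⟨p, q, r, s, h⟩
  refine Finite.subset (finite_iUnion fun p => finite_iUnion fun q => finite_iUnion fun r =>
    finite_iUnion fun s => ?_) this
  by_cases h : p ≠ q ∧ r ≠ s ∧ s(p, q) ≠ s(r, s)
  · exact (hB.transversal p q r s h.1 h.2.1 h.2.2).1.subset fun v hv => hv.2.2.2
  · exact Set.finite_empty.subset fun v hv => h ⟨hv.1, hv.2.1, hv.2.2.1⟩

theorem Admissible.eventually_not_arrangementVertex [Finite ι] (hB : B.Admissible) (x : Plane) :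
    ∀ᶠ y in 𝓝 x, y ≠ x → ¬ B.IsArrangementVertex y := by
  filter_upwards [(hB.finite_arrangementVertices.sdiff (t := {x})).isClosed.isOpen_compl.mem_nhds
    (by simp)] with y hy hyx hyv
  exact hy ⟨hyv, hyx⟩

theorem mem_diagram_pair_iff {p q : ι} (hpq : p ≠ q)
    {x : Plane} : x ∈ B.diagram {p, q} ↔ x ∈ B.bis p q := by
  rw [← not_iff_not, notMem_diagram_iff, mem_bis_iff hpq]
  simp only [mem_region_iff, mem_insert_iff, mem_singleton_iff, exists_eq_or_imp, exists_eq_left,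
    forall_eq_or_imp, forall_eq, ne_eq, not_true_eq_false, false_imp_iff, true_and, and_true,
    hpq, Ne.symm hpq, not_false_eq_true, true_imp_iff]
  tauto

namespace ArrangementGraph
variable {G : B.ArrangementGraph}

section Edges

variable {p q : ι} {α : Set Plane}

theorem ne_of_mem_edges (h : (s(p, q), α) ∈ G.edges) : p ≠ q := (G.edges_maximal p q α h).1

theorem edge_subset (h : (s(p, q), α) ∈ G.edges) : α ⊆ B.bis p q \ G.verts := by
  obtain ⟨-, x, -, rfl⟩ := G.edges_maximal p q α h
  exact connectedComponentIn_subset _ _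

theorem edge_nonempty {e : Sym2 ι × Set Plane} (h : e ∈ G.edges) : e.2.Nonempty := by
  obtain ⟨⟨p, q⟩, α⟩ := e
  obtain ⟨-, x, hx, rfl⟩ := G.edges_maximal p q α h
  exact ⟨x, mem_connectedComponentIn hx⟩

theorem isPreconnected_edge {e : Sym2 ι × Set Plane} (h : e ∈ G.edges) : IsPreconnected e.2 := by
  obtain ⟨⟨p, q⟩, α⟩ := e
  obtain ⟨-, x, hx, rfl⟩ := G.edges_maximal p q α h
  exact isPreconnected_connectedComponentIn

theorem edge_subset_carrier {e : Sym2 ι × Set Plane} (h : e ∈ G.edges) : e.2 ⊆ G.carrier :=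
  (subset_biUnion_of_mem (u := fun e : Sym2 ι × Set Plane => e.2) h).trans subset_union_right

theorem eq_of_mem_edge {e f : Sym2 ι × Set Plane} (he : e ∈ G.edges) (hf : f ∈ G.edges)
    {x : Plane} (hxe : x ∈ e.2) (hxf : x ∈ f.2) : e = f := by
  by_contra hne
  exact disjoint_left.1 (G.edges_disjoint e he f hf hne) hxe hxf

/-- An edge is closed apart from its end vertices. -/
theorem mem_edge_of_mem_closure {e : Sym2 ι × Set Plane} (h : e ∈ G.edges) {x : Plane}
    (hx : x ∈ closure e.2) (hxv : x ∉ G.verts) : x ∈ e.2 := by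
  obtain ⟨⟨p, q⟩, α⟩ := e
  have hsub := edge_subset h
  have hxJ : x ∈ B.bis p q :=
    (isClosed_bis (ne_of_mem_edges h)).closure_subset_iff.2 (fun y hy => (hsub hy).1) hx
  obtain ⟨-, x₀, hx₀, rfl⟩ := G.edges_maximal p q α h
  have : insert x (connectedComponentIn (B.bis p q \ G.verts) x₀) ⊆
      connectedComponentIn (B.bis p q \ G.verts) x₀ :=
    (isPreconnected_connectedComponentIn.subset_closure (subset_insert _ _)
      (insert_subset hx subset_closure)).subset_connectedComponentIn
      (mem_insert_of_mem _ (mem_connectedComponentIn hx₀)) (insert_subset ⟨hxJ, hxv⟩ hsub)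
  exact this (mem_insert _ _)

theorem finite_edges [Finite ι] (hB : B.Admissible) (G : B.ArrangementGraph) : G.edges.Finite := by
  have : G.edges ⊆ ⋃ p, ⋃ q, ⋃ (_ : p ≠ q), (Prod.mk s(p, q)) ''
      {α | ∃ x ∈ B.bis p q \ G.verts, α = connectedComponentIn (B.bis p q \ G.verts) x} := by
    rintro ⟨⟨p, q⟩, α⟩ h
    obtain ⟨hpq, hα⟩ := G.edges_maximal p q α h
    simp only [mem_iUnion]
    exact ⟨p, q, hpq, α, hα, rfl⟩
  exact Finite.subset (finite_iUnion fun p => finite_iUnion fun q => finite_iUnion fun hpq =>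
    (hB.finite_components hpq G.finite_verts).image _) this

theorem isClosed_carrier [Finite ι] (hB : B.Admissible) (G : B.ArrangementGraph) :
    IsClosed G.carrier := by
  have : G.carrier = G.verts ∪ ⋃ e ∈ G.edges, closure e.2 := by
    refine (union_subset_union_right _ (iUnion₂_mono fun _ _ => subset_closure)).antisymm ?_
    rintro x (hx | hx)
    · exact Or.inl hx
    · obtain ⟨e, he, hx⟩ := mem_iUnion₂.1 hx
      by_cases hxv : x ∈ G.verts
      · exact Or.inl hxv
      · exact edge_subset_carrier he (mem_edge_of_mem_closure he hx hxv)
  rw [this]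
  exact G.finite_verts.isClosed.union
    ((finite_edges hB G).isClosed_biUnion fun _ _ => isClosed_closure)

theorem exists_edge_of_mem_carrier {x : Plane} (hx : x ∈ G.carrier) (hxv : x ∉ G.verts) :
    ∃ p q α, (s(p, q), α) ∈ G.edges ∧ x ∈ α := by
  obtain ⟨⟨⟨p, q⟩, α⟩, he, hx⟩ := mem_iUnion₂.1 (hx.resolve_left hxv)
  exact ⟨p, q, α, he, hx⟩

/-- The sites involved in the edges that are incident to `x`. -/
def incidentSites (G : B.ArrangementGraph) (x : Plane) : Set ι :=
  {p | ∃ q α, (s(p, q), α) ∈ G.edges ∧ x ∈ closure α}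

theorem incidentSites_of_mem_edge (h : (s(p, q), α) ∈ G.edges) {x : Plane} (hx : x ∈ α) :
    G.incidentSites x = {p, q} := by
  ext a
  constructor
  · rintro ⟨b, β, hb, hxb⟩
    have := eq_of_mem_edge h hb hx (mem_edge_of_mem_closure hb hxb (edge_subset h hx).2)
    have hs : s(p, q) = s(a, b) := congrArg Prod.fst this
    have : a ∈ s(p, q) := hs ▸ Sym2.mem_mk_left a b
    simpa using this
  · rintro (rfl | rfl)
    · exact ⟨q, α, h, subset_closure hx⟩
    · exact ⟨p, α, Sym2.eq_swap ▸ h, subset_closure hx⟩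

theorem eventually_mem_edge [Finite ι] (hB : B.Admissible) (h : (s(p, q), α) ∈ G.edges)
    {x : Plane} (hx : x ∈ α) :
    ∀ᶠ y in 𝓝 x, (y ∈ G.carrier ↔ y ∈ α) ∧ (y ∈ α ↔ y ∈ B.bis p q) := by
  have hxJ := edge_subset h hx
  have hcomp : ∀ᶠ y in 𝓝 x, y ∈ B.bis p q → y ∈ α := by
    have := hB.eventually_mem_component (ne_of_mem_edges h) G.finite_verts.isClosed hxJ
    obtain ⟨-, x₀, hx₀, rfl⟩ := G.edges_maximal p q α h
    rwa [connectedComponentIn_eq hx]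
  have hother : ∀ᶠ y in 𝓝 x, ∀ f ∈ G.edges, f ≠ (s(p, q), α) → y ∉ f.2 := by
    refine (Filter.eventually_all_finite (finite_edges hB G)).2 fun f hf => ?_
    by_cases hne : f = (s(p, q), α)
    · exact Filter.Eventually.of_forall fun y h' => absurd hne h'
    · have : x ∉ closure f.2 := fun h' =>
        hne (eq_of_mem_edge hf h (mem_edge_of_mem_closure hf h' hxJ.2) hx)
      filter_upwards [isClosed_closure.isOpen_compl.mem_nhds this] with y hy _ hyf
      exact hy (subset_closure hyf)
  filter_upwards [hcomp, hother, G.finite_verts.isClosed.isOpen_compl.mem_nhds hxJ.2]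
    with y h₁ h₂ h₃
  refine ⟨⟨fun hy => ?_, fun hy => edge_subset_carrier h hy⟩, fun hy => (edge_subset h hy).1, h₁⟩
  obtain ⟨f, hf, hyf⟩ := mem_iUnion₂.1 (hy.resolve_left h₃)
  by_cases hne : f = (s(p, q), α)
  · rw [hne] at hyf; exact hyf
  · exact absurd hyf (h₂ f hf hne)

end Edges

/-- Near a locally Voronoi vertex, each edge lies on the bisector of those two sites that are the
best among the three of the vertex. There are no other arrangement vertices nearby, so the bisector
through a point of the graph is unique. -/
theorem eventually_top_eq [Finite ι] (hB : B.Admissible) {v : Plane} (p q r : ι) {N : Set Plane}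
    (hN : N ∈ 𝓝 v) (hGN : G.carrier ∩ N = B.diagram {p, q, r} ∩ N) :
    ∀ᶠ y in 𝓝 v, (y ∈ G.carrier ↔ y ∈ B.diagram {p, q, r}) ∧ (y ≠ v → y ∉ G.verts ∧
      ∀ a b α, (s(a, b), α) ∈ G.edges → y ∈ α → B.top y {p, q, r} = {a, b}) := by
  filter_upwards [hN, hB.eventually_not_arrangementVertex v] with y hyN hy
  have hiff : y ∈ G.carrier ↔ y ∈ B.diagram {p, q, r} := by
    have := congrArg (y ∈ ·) hGN
    simpa [hyN] using this
  refine ⟨hiff, fun hyv => ⟨fun h => hy hyv (G.verts_arrangement y h), fun a b α he hyα => ?_⟩⟩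
  have hyab := (edge_subset he hyα).1
  have hsym : ∀ c ∈ B.top y {p, q, r}, ∀ d ∈ B.top y {p, q, r}, c ≠ d → s(a, b) = s(c, d) := by
    intro c hc d hd hcd
    by_contra hne
    exact hy hyv ⟨a, b, c, d, ne_of_mem_edges he, hcd, hne, hyab, mem_bis_of_tie hc hd hcd⟩
  obtain ⟨c, hc, d, hd, hcd⟩ := (hB.mem_diagram_iff (by simp)).1
    (hiff.1 (edge_subset_carrier he hyα))
  have hab : ({a, b} : Set ι) = {c, d} := by
    ext z
    have : z ∈ s(a, b) ↔ z ∈ s(c, d) := by rw [hsym c hc d hd hcd]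
    simpa using this
  rw [hab]
  refine Subset.antisymm (fun z hz => ?_) (pair_subset hc hd)
  by_cases hzc : z = c
  · exact Or.inl hzc
  · have : z ∈ s(a, b) := hsym c hc z hz (Ne.symm hzc) ▸ Sym2.mem_mk_right c z
    rw [hsym c hc d hd hcd] at this
    simpa using this

/-- By transversality, the part of `bis p q` on which `p` and `q` are better than `r` reaches a
vertex defined by the three sites, and so does one of the finitely many edges on it. -/
theorem mem_incidentSites_of_locallyVoronoi [Finite ι] (hB : B.Admissible) {v : Plane}
    {p q r : ι} (hpq : p ≠ q) (hpr : p ≠ r) (hqr : q ≠ r) (hv₁ : v ∈ B.bis p q)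
    (hv₂ : v ∈ B.bis p r) {N : Set Plane} (hN : N ∈ 𝓝 v)
    (hGN : G.carrier ∩ N = B.diagram {p, q, r} ∩ N) :
    p ∈ G.incidentSites v ∧ v ∈ closure (B.region p {p, q, r}) := by
  have ht := ((hB.transversal p q p r hpq hpr (by
    simp only [ne_eq, Sym2.eq_iff, not_or]
    exact ⟨fun h => hqr h.2, fun h => hpr h.1⟩)).2 v ⟨hv₁, hv₂⟩).1.1
  constructor
  · have hcl : v ∈ closure (⋃ e ∈ {e ∈ G.edges | p ∈ e.1}, e.2) := by
      rw [mem_closure_iff_nhds]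
      intro M hM
      obtain ⟨y, ⟨⟨h₁, h₂⟩, hyM⟩, hypq, hypr⟩ := mem_closure_iff_nhds.1 ht _
        (Filter.inter_mem (eventually_top_eq hB p q r hN hGN) hM)
      have hbpr : B.Beats y p r := ⟨hpr, hypr⟩
      have hyv : y ≠ v := by
        rintro rfl
        exact ((mem_bis_iff hpr).1 hv₂).1 hbpr
      have htie := (mem_bis_iff hpq).1 hypq
      have hpt : p ∈ B.top y {p, q, r} := by
        refine ⟨by simp, ?_⟩
        rintro s (rfl | rfl | rfl)
        exacts [beats_irrefl y _, htie.2, hbpr.asymm]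
      have hqt : q ∈ B.top y {p, q, r} := by
        refine ⟨by simp, ?_⟩
        rintro s (rfl | rfl | rfl)
        exacts [htie.1, beats_irrefl y _, fun h => htie.1 (hB.beats_trans hbpr h)]
      have hyG := h₁.2 ((hB.mem_diagram_iff (by simp)).2 ⟨p, hpt, q, hqt, hpq⟩)
      obtain ⟨a, b, α, he, hyα⟩ := exists_edge_of_mem_carrier hyG (h₂ hyv).1
      rw [(h₂ hyv).2 a b α he hyα] at hpt
      exact ⟨y, hyM, mem_biUnion (x := (s(a, b), α)) ⟨he, by simpa using hpt⟩ hyα⟩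
    rw [((finite_edges hB G).subset (sep_subset _ _)).closure_biUnion] at hcl
    obtain ⟨⟨e, α⟩, ⟨he, b, rfl⟩, hvα⟩ := mem_iUnion₂.1 hcl
    exact ⟨b, α, he, hvα⟩
  · rw [mem_closure_iff]
    intro M hM hvM
    obtain ⟨y, hyM, hypq, hypr⟩ := mem_closure_iff.1 ht M hM hvM
    obtain ⟨z, ⟨hzM, hzr⟩, hzq⟩ := mem_closure_iff.1 (mem_closure_dom hpq hypq) _
      (hM.inter (B.isOpen_dom p r hpr)) ⟨hyM, hypr⟩
    refine ⟨z, hzM, mem_region_iff.2 ?_⟩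
    rintro s (rfl | rfl | rfl) hs
    exacts [absurd rfl hs, ⟨hpq, hzq⟩, ⟨hpr, hzr⟩]

theorem exists_incidentSites_eq [Finite ι] (hB : B.Admissible) {v : Plane} (hv : v ∈ G.verts)
    (hG : G.IsLocallyVoronoi v) : ∃ p q r, p ≠ q ∧ p ≠ r ∧ q ≠ r ∧ v ∈ B.bis p q ∧ v ∈ B.bis q r ∧
      v ∈ B.bis p r ∧ G.incidentSites v = {p, q, r} ∧
      (∀ s ∈ ({p, q, r} : Set ι), v ∈ closure (B.region s {p, q, r})) ∧
      ∃ N ∈ 𝓝 v, G.carrier ∩ N = B.diagram {p, q, r} ∩ N := by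
  obtain ⟨p, q, r, hpq, hpr, hqr, h₁, h₂, h₃, N, hN, hGN⟩ := hG
  have hp := mem_incidentSites_of_locallyVoronoi hB hpq hpr hqr h₁ h₃ hN hGN
  have hq := mem_incidentSites_of_locallyVoronoi hB hpq.symm hqr hpr (B.bis_symm p q ▸ h₁) h₂ hN
    (insert_comm p q {r} ▸ hGN)
  have hperm : ({p, q, r} : Set ι) = {r, p, q} := by
    rw [insert_comm r p, pair_comm r q]
  have hr := mem_incidentSites_of_locallyVoronoi hB hpr.symm hqr.symm hpq (B.bis_symm p r ▸ h₃)
    (B.bis_symm q r ▸ h₂) hN (hperm ▸ hGN)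
  rw [← hperm] at hr
  rw [insert_comm q p] at hq
  refine ⟨p, q, r, hpq, hpr, hqr, h₁, h₂, h₃, Subset.antisymm ?_ ?_, ?_, N, hN, hGN⟩
  · rintro a ⟨b, α, he, hvα⟩
    obtain ⟨y, hy, hyα⟩ := mem_closure_iff_nhds.1 hvα _ (eventually_top_eq hB p q r hN hGN)
    have hyv : y ≠ v := by
      rintro rfl
      exact (edge_subset he hyα).2 hv
    have : a ∈ B.top y {p, q, r} := by
      rw [(hy.2 hyv).2 a b α he hyα]
      exact mem_insert _ _
    exact this.1
  · rintro s (rfl | rfl | rfl)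
    exacts [hp.1, hq.1, hr.1]
  · rintro s (rfl | rfl | rfl)
    exacts [hp.2, hq.2, hr.2]

theorem isLocalDiagram [Finite ι] (hB : B.Admissible)
    (hG : ∀ v ∈ G.verts, G.IsLocallyVoronoi v) :
    B.IsLocalDiagram G.carrier G.incidentSites := by
  have hedge : ∀ {x p q α}, (s(p, q), α) ∈ G.edges → x ∈ α →
      ∀ s ∈ ({p, q} : Set ι), x ∈ closure (B.region s {p, q}) := by
    intro x p q α he hx s hs
    have hpq := ne_of_mem_edges he
    have hxJ := (edge_subset he hx).1
    rcases hs with rfl | rfl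
    · convert mem_closure_dom hpq hxJ using 2
      ext y
      simp [mem_region_iff, Beats, hpq, hpq.symm]
    · rw [B.bis_symm] at hxJ
      convert mem_closure_dom hpq.symm hxJ using 2
      ext y
      simp [mem_region_iff, Beats, hpq, hpq.symm]
  have hdata : ∀ x ∈ G.carrier, (∃ p q α, (s(p, q), α) ∈ G.edges ∧ x ∈ α) ∨ x ∈ G.verts :=
    fun x hx => (em (x ∈ G.verts)).symm.imp (exists_edge_of_mem_carrier hx) id
  refine ⟨isClosed_carrier hB G, fun x hx => ?_, fun x hx => ?_, fun x hx => ?_, fun x hx => ?_⟩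
  all_goals rcases hdata x hx with ⟨p, q, α, he, hxα⟩ | hv
  · rw [incidentSites_of_mem_edge he hxα]
    exact nontrivial_pair (ne_of_mem_edges he)
  · obtain ⟨p, q, r, hpq, -, -, -, -, -, hT, -⟩ := exists_incidentSites_eq hB hv (hG x hv)
    rw [hT]
    exact ⟨p, by simp, q, by simp, hpq⟩
  · rw [incidentSites_of_mem_edge he hxα]
    have h := (mem_bis_iff (ne_of_mem_edges he)).1 (edge_subset he hxα).1
    rintro a (rfl | rfl) b (rfl | rfl)
    exacts [beats_irrefl _ _, h.1, h.2, beats_irrefl _ _]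
  · obtain ⟨p, q, r, hpq, hpr, hqr, h₁, h₂, h₃, hT, -⟩ := exists_incidentSites_eq hB hv (hG x hv)
    rw [hT]
    rw [mem_bis_iff hpq] at h₁
    rw [mem_bis_iff hqr] at h₂
    rw [mem_bis_iff hpr] at h₃
    rintro a (rfl | rfl | rfl) b (rfl | rfl | rfl)
    exacts [beats_irrefl _ _, h₁.1, h₃.1, h₁.2, beats_irrefl _ _, h₂.1, h₃.2, h₂.2,
      beats_irrefl _ _]
  · rw [incidentSites_of_mem_edge he hxα]
    exact hedge he hxα
  · obtain ⟨p, q, r, -, -, -, -, -, -, hT, hcl, -⟩ := exists_incidentSites_eq hB hv (hG x hv)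
    rw [hT]
    exact hcl
  · rw [incidentSites_of_mem_edge he hxα]
    filter_upwards [eventually_mem_edge hB he hxα] with y hy
    have hpq := ne_of_mem_edges he
    refine ⟨hy.1.trans (hy.2.trans (mem_diagram_pair_iff hpq).symm), fun hyG => ?_⟩
    rw [incidentSites_of_mem_edge he (hy.1.1 hyG)]
    have h := (mem_bis_iff hpq).1 (hy.2.1 (hy.1.1 hyG))
    refine Subset.antisymm ?_ (sep_subset _ _)
    rintro a (rfl | rfl)
    · refine ⟨by simp, ?_⟩
      rintro b (rfl | rfl)
      exacts [beats_irrefl _ _, h.2]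
    · refine ⟨by simp, ?_⟩
      rintro b (rfl | rfl)
      exacts [h.1, beats_irrefl _ _]
  · obtain ⟨p, q, r, hpq, hpr, hqr, h₁, h₂, h₃, hT, -, N, hN, hGN⟩ :=
      exists_incidentSites_eq hB hv (hG x hv)
    filter_upwards [eventually_top_eq hB p q r hN hGN] with y hy
    rw [hT]
    refine ⟨hy.1, fun hyG => ?_⟩
    by_cases hyx : y = x
    · rw [hyx, hT]
      rw [mem_bis_iff hpq] at h₁
      rw [mem_bis_iff hqr] at h₂
      rw [mem_bis_iff hpr] at h₃
      refine Subset.antisymm (fun a ha => ⟨ha, ?_⟩) (sep_subset _ _)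
      rintro b (rfl | rfl | rfl) <;> rcases ha with rfl | rfl | rfl
      exacts [beats_irrefl _ _, h₁.1, h₃.1, h₁.2, beats_irrefl _ _, h₂.1, h₃.2, h₂.2,
        beats_irrefl _ _]
    · obtain ⟨a, b, α, he, hyα⟩ := exists_edge_of_mem_carrier hyG (hy.2 hyx).1
      rw [incidentSites_of_mem_edge he hyα, (hy.2 hyx).2 a b α he hyα]

theorem relevant_eq_sites (G : B.ArrangementGraph) :
    relevant G.carrier G.incidentSites = G.sites := by
  ext p
  constructor
  · intro hp
    obtain ⟨x, -, q, α, he, -⟩ := mem_iUnion₂.1 hp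
    exact ⟨q, α, he⟩
  · rintro ⟨q, α, he⟩
    obtain ⟨x, hx⟩ := edge_nonempty he
    exact mem_relevant (edge_subset_carrier he hx) ⟨q, α, he, subset_closure hx⟩

end ArrangementGraph
end BisectorSystem

/-! ### Voronoi-like graphs -/

namespace BisectorSystem
variable {ι : Type*} {B : BisectorSystem ι}
namespace ArrangementGraph
variable {G : B.ArrangementGraph}

open Metric

theorem exists_edge_of_mem_incidentSites {x : Plane} (hxv : x ∉ G.verts)
    {p : ι} (hp : p ∈ G.incidentSites x) :
    ∃ q α, (s(p, q), α) ∈ G.edges ∧ x ∈ α ∧ G.incidentSites x = {p, q} := by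
  obtain ⟨q, α, he, hxα⟩ := hp
  have := mem_edge_of_mem_closure he hxα hxv
  exact ⟨q, α, he, this, incidentSites_of_mem_edge he this⟩

/-- Away from the vertices and from `K`, the label of a point near the graph is a label of its
sector in the sense of `HasLabel`. -/
theorem eventually_hasLabel [Finite ι] (hB : B.Admissible)
    (hG : ∀ v ∈ G.verts, G.IsLocallyVoronoi v) {K : Set Plane} (hK : IsClosed K) {x : Plane}
    (hx : x ∈ G.carrier) (hxv : x ∉ G.verts) (hxK : x ∉ K) :
    ∀ᶠ y in 𝓝 x, y ∉ G.carrier → ∃ p ∈ G.incidentSites x,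
      y ∈ B.region p (G.incidentSites x) ∧
      G.HasLabel K (connectedComponentIn (K ∪ G.carrier)ᶜ y) p := by
  obtain ⟨a, b, α, he, hxα⟩ := exists_edge_of_mem_carrier hx hxv
  obtain ⟨r, hr, hball⟩ := Metric.mem_nhds_iff.1 (Filter.inter_mem
    (Filter.inter_mem (eventually_mem_edge hB he hxα) (hK.isOpen_compl.mem_nhds hxK))
    ((isLocalDiagram hB hG).eventually x hx))
  filter_upwards [ball_mem_nhds x hr] with y hy hyG
  have hyT := (hball hy).2.1
  obtain ⟨p, hp, hyp⟩ := notMem_diagram_iff.1 fun h => hyG (hyT.2 h)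
  refine ⟨p, hp, hyp, ?_⟩
  obtain ⟨q, β, hβ, hxβ, hT⟩ := exists_edge_of_mem_incidentSites hxv hp
  have hαβ : (s(a, b), α) = (s(p, q), β) := eq_of_mem_edge he hβ hxα hxβ
  have hpq := ne_of_mem_edges hβ
  have hyd : y ∈ B.dom p q := (mem_region_iff.1 hyp q (by rw [hT]; simp) hpq.symm).2
  -- the component of `y` in the punctured ball reaches the edge inside of the ball
  set V := connectedComponentIn (ball x r \ G.carrier) y
  have hyV : y ∈ V := mem_connectedComponentIn ⟨hy, hyG⟩
  have hVsub : V ⊆ ball x r \ G.carrier := connectedComponentIn_subset _ _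
  have hVopen : IsOpen V := (isOpen_ball.sdiff (isClosed_carrier hB G)).connectedComponentIn
  have hVU : V ⊆ connectedComponentIn (K ∪ G.carrier)ᶜ y :=
    connectedComponentIn_mono _ fun z hz => by
      simp only [mem_compl_iff, mem_union, not_or]
      exact ⟨(hball hz.1).1.2, hz.2⟩
  have hVdom : V ⊆ B.dom p q := by
    refine isPreconnected_connectedComponentIn.subset_left_of_subset_union (B.isOpen_dom p q hpq)
      (B.isOpen_dom q p hpq.symm) (B.disjoint_dom p q hpq) ?_ ⟨y, hyV, hyd⟩
    intro z hz
    rw [← B.compl_bis p q hpq]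
    intro hzJ
    have h := (hball (hVsub hz).1).2.1
    rw [hT, mem_diagram_pair_iff hpq] at h
    exact (hVsub hz).2 (h.2 hzJ)
  obtain ⟨z, hzV, hzb, hzV'⟩ : ∃ z ∈ closure V, z ∈ ball x r ∧ z ∉ V := by
    by_contra! h
    have := (isPreconnected_ball (x := x) (r := r)).subset_of_closure_inter_subset hVopen
      ⟨y, hy, hyV⟩ (fun z hz => h z hz.1 hz.2) (mem_ball_self hr)
    exact (hVsub this).2 hx
  have hzG : z ∈ G.carrier := by
    by_contra hzG
    have hins : insert z V ⊆ V :=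
      (isPreconnected_connectedComponentIn.subset_closure (subset_insert z V)
        (insert_subset hzV subset_closure)).subset_connectedComponentIn
        (mem_insert_of_mem _ hyV)
        (insert_subset (show z ∈ ball x r \ G.carrier from ⟨hzb, hzG⟩) hVsub)
    exact hzV' (hins (mem_insert z V))
  have hzβ : z ∈ β := by
    have := (hball hzb).1.1.1.1 hzG
    rwa [show α = β from congrArg Prod.snd hαβ] at this
  exact ⟨q, β, hβ, z, ⟨hzβ, (hball hzb).1.2⟩, closure_mono (subset_inter hVU hVdom) hzV⟩

theorem exists_labelling [Finite ι] [Nonempty ι] (hB : B.Admissible)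
    (hG : G.IsVoronoiLike) : ∃ l, B.IsLabelling G.carrier G.incidentSites l := by
  classical
  have hL := isLocalDiagram hB hG.locallyVoronoi
  by_cases hc : IsConnected G.carrier
  · exact hL.exists_labelling_of_isPreconnected hB hc.isPreconnected
  obtain ⟨K, hK, hcons⟩ := hG.consistent hc
  obtain ⟨R₀, hR₀⟩ := (hK.isBounded.union G.finite_verts.isBounded).subset_closedBall 0
  obtain ⟨R, hR, hKR⟩ : ∃ R, 0 ≤ R ∧ K ∪ G.verts ⊆ closedBall 0 R :=
    ⟨max R₀ 0, le_max_right _ _, hR₀.trans (closedBall_subset_closedBall (le_max_left _ _))⟩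
  have : Finite G.edges := finite_edges hB G
  have : Finite G.verts := G.finite_verts
  have hcover : G.carrier = ⋃ i : G.verts ⊕ G.edges, i.elim (fun v => {v.1}) (fun e => e.1.2) := by
    ext x
    simp [carrier]
  refine hL.exists_labelling_of_outside hB (κ := G.verts ⊕ G.edges) ?_ hcover hR
    (c := fun y => if h : ∃ p, G.HasLabel K (connectedComponentIn (K ∪ G.carrier)ᶜ y) p
      then h.choose else Classical.arbitrary ι) ?_ ?_
  · rintro (v | e)
    · exact isPreconnected_singleton
    · exact isPreconnected_edge e.2
  · intro y hy
    have hyU : y ∈ (K ∪ G.carrier)ᶜ := fun h => hy (h.imp (fun h => hKR (Or.inl h)) id)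
    have hopen : IsOpen (K ∪ G.carrier)ᶜ := (hK.isClosed.union hL.isClosed).isOpen_compl
    filter_upwards [hopen.connectedComponentIn.mem_nhds (mem_connectedComponentIn hyU)] with z hz
    rw [connectedComponentIn_eq hz]
  · intro x hx hxR
    filter_upwards [eventually_hasLabel hB hG.locallyVoronoi hK.isClosed hx
      (fun h => hxR (hKR (Or.inr h))) (fun h => hxR (hKR (Or.inl h))),
      isClosed_closedBall.isOpen_compl.mem_nhds hxR] with y hy hyR hyG
    obtain ⟨p, hp, hyp, hlab⟩ := hy hyG
    have h : ∃ p, G.HasLabel K (connectedComponentIn (K ∪ G.carrier)ᶜ y) p := ⟨p, hlab⟩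
    have heq : h.choose = p := hcons y (fun h => h.elim (fun h => hyR (hKR (Or.inl h))) hyG) _ _
      h.choose_spec hlab
    simp only [dif_pos h, heq]
    exact ⟨hp, hyp⟩

theorem verts_eq_voronoiVertices [Finite ι] (hB : B.Admissible)
    (hG : ∀ v ∈ G.verts, G.IsLocallyVoronoi v) {l : Plane → ι}
    (hl : B.IsLabelling G.carrier G.incidentSites l) (hne : G.carrier.Nonempty) :
    G.verts = B.voronoiVertices G.sites := by
  have hL := isLocalDiagram hB hG
  have hcl : ∀ {x}, x ∈ G.carrier → ∀ {p}, p ∈ G.sites →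
      (x ∈ closure (B.region p G.sites) ↔ p ∈ G.incidentSites x) := by
    intro x hx p hp
    rw [← relevant_eq_sites] at hp ⊢
    exact hl.mem_closure_region_iff hB hL hx hp
  have hsites : ∀ {x p}, p ∈ G.incidentSites x → p ∈ G.sites := fun ⟨q, α, he, _⟩ => ⟨q, α, he⟩
  ext v
  constructor
  · intro hv
    have hvG : v ∈ G.carrier := Or.inl hv
    obtain ⟨p, q, r, hpq, hpr, hqr, -, -, -, hT, -⟩ := exists_incidentSites_eq hB hv (hG v hv)
    have hp : p ∈ G.incidentSites v := by rw [hT]; simp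
    have hq : q ∈ G.incidentSites v := by rw [hT]; simp
    have hr : r ∈ G.incidentSites v := by rw [hT]; simp
    exact ⟨p, hsites hp, q, hsites hq, r, hsites hr, hpq, hpr, hqr, (hcl hvG (hsites hp)).2 hp,
      (hcl hvG (hsites hq)).2 hq, (hcl hvG (hsites hr)).2 hr⟩
  · rintro ⟨p, hp, q, hq, r, hr, hpq, hpr, hqr, hvp, hvq, hvr⟩
    have hvG : v ∈ G.carrier := by
      rw [hl.eq_diagram hB hL hne, relevant_eq_sites]
      by_contra h
      obtain ⟨s, hs, hvs⟩ := notMem_diagram_iff.1 h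
      have hall : ∀ t ∈ G.sites, v ∈ closure (B.region t G.sites) → t = s := by
        intro t ht hvt
        by_contra hne
        obtain ⟨z, hzs, hzt⟩ := mem_closure_iff.1 hvt _ (isOpen_region s _) hvs
        exact disjoint_left.1 (disjoint_region ht hs hne) hzt hzs
      exact hpq ((hall p hp hvp).trans (hall q hq hvq).symm)
    by_contra hv
    rw [hcl hvG hp] at hvp
    rw [hcl hvG hq] at hvq
    rw [hcl hvG hr] at hvr
    obtain ⟨a, α, -, -, hT⟩ := exists_edge_of_mem_incidentSites hv hvp
    rw [hT] at hvq hvr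
    have h₁ : q = a := hvq.resolve_left hpq.symm
    have h₂ : r = a := hvr.resolve_left hpr.symm
    exact hqr (h₁.trans h₂.symm)

end ArrangementGraph
end BisectorSystem

open BisectorSystem ArrangementGraph in
theorem mainTheorem2 {ι : Type*} [Finite ι] (B : BisectorSystem ι)
    (hB : B.Admissible) (hgen : B.GeneralPosition)
    (G : B.ArrangementGraph) (hne : G.edges.Nonempty) (hG : G.IsVoronoiLike) :
    G.carrier = B.diagram G.sites ∧ G.verts = B.voronoiVertices G.sites := by
  obtain ⟨⟨⟨p, q⟩, α⟩, he⟩ := hne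
  obtain ⟨x, hx⟩ := edge_nonempty he
  have hcne : G.carrier.Nonempty := ⟨x, edge_subset_carrier he hx⟩
  have : Nonempty ι := ⟨p⟩
  obtain ⟨l, hl⟩ := exists_labelling hB hG
  refine ⟨?_, verts_eq_voronoiVertices hB hG.locallyVoronoi hl hcne⟩
  rw [hl.eq_diagram hB (isLocalDiagram hB hG.locallyVoronoi) hcne, relevant_eq_sites]
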